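/- **Setting.** Let $J\ge 1$, let $b_1,\dots,b_J>0$ with $\sum_{j}b_j=1$, and consider a sequence of LRU caches indexed by $n$. The $n$-th cache has integer size $C_n$ and serves $N_n$ unit-sized contents (for example $N_n=n$), where $N_n\to\infty$. Contents are labelled $(j,k)$, with $1\le j\le J$ and $1\le k\le m_{n,j}$, where $\sum_j m_{n,j}=N_n$ and class $j$ holds asymptotically a fraction $b_j$ of the contents: $m_{n,j}/N_n\to b_j$. The cache sizes satisfy $C_n\sim\beta_0N_n$ for some $\beta_0\in(0,1)$. For each $n$, the request times of the contents $(j,k)$ form independent stationary and ergodic simple point processes $N_{n,j,k}$ on $\mathbb R$, with intensities $\lambda_{n,j,k}\in(0,\infty)$. Put $p_{n,j,k}=\lambda_{n,j,k}/\sum_{j',k'}\lambda_{n,j',k'}$. Let $\mathbb P^0_{n,j,k}$ be the Palm probability of $N_{n,j,k}$, let $\mathbb P^0_n$ be the Palm probability of the superposition of all the $N_{n,j,k}$, and let $G_{n,j,k}(t)$ be the $\mathbb P^0_{n,j,k}$-probability that the first request for $(j,k)$ after time $0$ occurs no later than $t$. The LRU hit probability $H_n^{\rm LRU}$ is the $\mathbb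 P_n^0$-probability that the content requested at time $0$ is also requested during $[-\tau_n,0)$, where $\tau_n$ is the infimum of those $t$ for which at least $C_n$ distinct contents are requested during $[-t,0)$. For each class $j$ assume: (a) $G_{n,j,k}(t)=\Psi_j(\lambda_{n,j,k}t)$ for all $n,k,t$, where $\Psi_j$ is a continuous cdf with support in $[0,\infty)$ and mean $1$; (b) there are a continuous function $f_j$ on $(0,1]$ with $f_j>0$ a.e. and $\lim_{x\to0+}f_j(x)\in[0,+\infty]$, and points $z_{n,j,k}\in\left[\frac{k-1}{m_{n,j}},\frac{k}{m_{n,j}}\right]\cap(0,1]$, such that $$\max_{1\le k\le m_{n,j}}\left|\frac{f_j(z_{n,j,k})}{N_n\,p_{n,j,k}}-1\right|\to0\quad\text{as } n\to\infty .$$ If $\lim_{x\to 0+}f_j(x)=+\infty$ for at least one $j$, assume moreover that the profiles are normalised: $\sum_{j=1}^J b_j\int_0^1 f_j(x)\,dx=1$. Write $\hat\Psi_j(t)=\int_0^t(1-\Psi_j(u))\,du$ for $t\ge 0$. **Proposition.** There is a unique $\nu_0\in(0,\infty)$ such that $$\sum_{j=1}^J b_j\int_0^1\hat\Psi_j(\nu_0f_j(x))\,dx=\beta_0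 .$$ For this $\nu_0$ the functions $x\mapsto f_j(x)\Psi_j(\nu_0f_j(x))$ are integrable on $(0,1)$, and $$H^{\rm LRU}_n\to\sum_{j=1}^J b_j\int_0^1 f_j(x)\,\Psi_j(\nu_0f_j(x))\,dx\quad\text{as } n\to\infty .$$ -/

import Mathlib

open MeasureTheory ProbabilityTheory Filter Topology Set
open scoped ENNReal

noncomputable section

/-- A realisation of a simple point process on the real line: a locally finite set of points. -/
@[ext]
structure PointConfig where
  points : Set ℝ
  finite_inter : ∀ a b : ℝ, (points ∩ Icc a b).Finite

namespace PointConfig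

/-- The counting measure of a configuration: `S.counting B` is the number of points of `S` in `B`. -/
def counting (S : PointConfig) : Measure ℝ := Measure.count.restrict S.points

/-- The usual σ-algebra on configurations, generated by the maps `S ↦ S.counting B`, `B` Borel. -/
instance : MeasurableSpace PointConfig :=
  MeasurableSpace.comap counting inferInstance

/-- The configuration seen from time `s`: a point at `x` is moved to `x - s`. -/
def shift (s : ℝ) (S : PointConfig) : PointConfig where
  points := {x | x + s ∈ S.points}
  finite_inter a b := by
    refine Finite.of_finite_image (f := fun x => x + s)
      ((S.finite_inter (a + s) (b + s)).subset ?_) (add_left_injective s).injOn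
    rintro _ ⟨x, ⟨hx, hxa, hxb⟩, rfl⟩
    exact ⟨hx, by simpa using hxa, by simpa using hxb⟩

/-- The superposition of finitely many configurations. -/
def superpose {ι : Type*} [Fintype ι] (ξ : ι → PointConfig) : PointConfig where
  points := ⋃ i, (ξ i).points
  finite_inter a b := by
    rw [iUnion_inter]
    exact finite_iUnion fun i => (ξ i).finite_inter a b

end PointConfig

/-- `N` is a stationary and ergodic simple point process under `P`: it is measurable, its law is
invariant under all time shifts, and every shift-invariant event has probability zero or one. -/
structure IsStationaryErgodic {Ω : Type*} [MeasurableSpace Ω] (P : Measure Ω)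
    (N : Ω → PointConfig) : Prop where
  measurable : Measurable N
  stationary : ∀ s : ℝ, MeasurePreserving (PointConfig.shift s) (P.map N) (P.map N)
  ergodic : ∀ A : Set PointConfig, MeasurableSet A →
    (∀ s : ℝ, PointConfig.shift s ⁻¹' A = A) → P.map N A = 0 ∨ P.map N A = 1

/-- The intensity of a (stationary) point process: the mean number of points in `(0, 1]`. -/
def intensity {Ω : Type*} [MeasurableSpace Ω] (P : Measure Ω) (N : Ω → PointConfig) : ℝ≥0∞ :=
  ∫⁻ ω, (N ω).counting (Ioc 0 1) ∂P

/-- The Palm probability, with respect to the point process `N`, of an event `A` about the family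
of point processes `ξ` (all jointly stationary):
`P⁰_N[A] = E[#{s ∈ N ∩ (0, 1] : (ξ shifted so that s becomes the origin) ∈ A}] / E[#(N ∩ (0, 1])]`. -/
def palmProb {Ω : Type*} [MeasurableSpace Ω] (P : Measure Ω) {ι : Type*}
    (ξ : Ω → ι → PointConfig) (N : Ω → PointConfig) (A : Set (ι → PointConfig)) : ℝ≥0∞ :=
  (∫⁻ ω, (N ω).counting {s | s ∈ Ioc (0 : ℝ) 1 ∧ (fun i => (ξ ω i).shift s) ∈ A} ∂P)
    / intensity P N

section Cache

variable {ι : Type*}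

open Classical in
/-- `requested ξ i t` is `1` if content `i` is requested during `[-t, 0)`, and `0` otherwise;
`t = ∞` is allowed. -/
def requested (ξ : ι → PointConfig) (i : ι) (t : ℝ≥0∞) : ℕ :=
  if ∃ x ∈ (ξ i).points, x < 0 ∧ ENNReal.ofReal (-x) ≤ t then 1 else 0

/-- The number of distinct contents requested during `[-t, 0)`. -/
def numRequested [Fintype ι] (ξ : ι → PointConfig) (t : ℝ≥0∞) : ℕ := ∑ i, requested ξ i t

/-- The length of the smallest past interval in which `C` distinct contents are requested
(`∞` if there is none). -/
def evictionTime [Fintype ι] (C : ℕ) (ξ : ι → PointConfig) : ℝ≥0∞ :=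
  sInf {t | C ≤ numRequested ξ t}

/-- The event that the content requested at time `0` is found in an LRU cache of size `C`, i.e. it
is among the `C` distinct most recently requested contents. (Almost surely at most one content is
requested at a time.) -/
def lruHit [Fintype ι] (C : ℕ) : Set (ι → PointConfig) :=
  {ξ | ∃ i, 0 ∈ (ξ i).points ∧ requested ξ i (evictionTime C ξ) = 1}

variable {Ω : Type*} [MeasurableSpace Ω]

/-- The stationary hit probability of an LRU cache of size `C`, under the Palm probability of the
superposition of all request processes `R i`. -/
def lruHitProb [Fintype ι] (P : Measure Ω) (R : ι → Ω → PointConfig) (C : ℕ) : ℝ :=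
  (palmProb P (fun ω i => R i ω) (fun ω => PointConfig.superpose fun i => R i ω)
    (lruHit C)).toReal

/-- The inter-request cdf of content `i`: the probability, under the Palm probability of its own
request process, that the first request for `i` after time `0` occurs no later than `t`. -/
def interRequestCdf (P : Measure Ω) (R : ι → Ω → PointConfig) (i : ι) (t : ℝ) : ℝ :=
  (palmProb P (fun ω i => R i ω) (R i) {ξ | ∃ x ∈ (ξ i).points, 0 < x ∧ x ≤ t}).toReal

/-- The request rate of content `i`. -/
def rate (P : Measure Ω) (R : ι → Ω → PointConfig) (i : ι) : ℝ := (intensity P (R i)).toReal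

/-- The popularity of content `i`: its share of the total request rate. -/
def popularity [Fintype ι] (P : Measure Ω) (R : ι → Ω → PointConfig) (i : ι) : ℝ :=
  rate P R i / ∑ l, rate P R l

end Cache

/-- The age distribution of a distribution `F` on `[0, ∞)` with mean `m`:
`t ↦ (1 / m) ∫₀ᵗ (1 - F(z)) dz`. -/
def ageCdf (F : Measure ℝ) (t : ℝ) : ℝ :=
  (∫ x, x ∂F)⁻¹ * ∫ z in (0 : ℝ)..t, (1 - cdf F z)

end

/-! Write `N` for the number of contents, `Λ` for the total rate, and look back from a request over
a window of length `t = νN/Λ`. The number of distinct contents requested there is a sum of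
independent indicators, so its variance is at most `N`. By the Palm–Khinchin formula its mean is the
sum of the age distributions at `λt = νNp`, which is asymptotically `N` times `occupancy` at `ν`.
Chebyshev's inequality bounds the probability of a deviation by `δN` by `1/(δ²N)`. Since `occupancy`
is strictly increasing as long as it is below one, the window typically holds fewer than `C`
contents if `ν < ν₀` and at least `C` if `ν > ν₀`. The eviction time is then at least, respectively
at most, `t`. So the hit probability is squeezed between the sums of `p G(t)` at times just below
and just above the critical one. These sums converge to `profileHit` at `ν`, and continuity lets `ν`
tend to `ν₀`.

Two points need care on the probabilistic side. Under the Palm measure of content `i` the other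
processes keep their law, by independence; Chebyshev is therefore applied to the contents other than
`i`, which changes the count by at most one (`lruHitProb_le`, `le_lruHitProb`). Moreover the cache
looks into the past, whereas `G` describes the time to the next request. Decomposing the event that
an interval contains a point according to its last or its first point gives two integral formulas
for one probability; hence both recurrence times have the same law
(`palmMeasure_backward_eq_forward`).

On the analytic side, the rescaled popularities `Np` form step functions converging pointwise to the
profiles, which may be unbounded at `0`. Their weighted total mass is one, so Fatou's lemma makes
the profiles integrable. The limits also have total mass one, and Scheffé's lemma upgrades pointwise
convergence to convergence in `L¹`, which suffices for the sums weighted by popularity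
(`tendsto_profile_sums`). -/

namespace PointConfig

/-! ### Counting measures of configurations and joint measurability -/

lemma countable_points (S : PointConfig) : S.points.Countable := by
  have h : S.points = ⋃ k : ℤ, S.points ∩ Icc (k : ℝ) (k + 1) := by
    rw [← inter_iUnion, iUnion_Icc_intCast, inter_univ]
  rw [h]
  exact countable_iUnion fun k => (S.finite_inter _ _).countable

lemma counting_apply (S : PointConfig) (B : Set ℝ) :
    S.counting B = ((B ∩ S.points).encard : ℝ≥0∞) := by
  rw [counting, Measure.restrict_apply' S.countable_points.measurableSet,
    Measure.count_apply (S.countable_points.mono inter_subset_right).measurableSet]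

lemma counting_eq_zero_iff (S : PointConfig) (B : Set ℝ) :
    S.counting B = 0 ↔ ∀ x ∈ S.points, x ∉ B := by
  rw [counting_apply]
  simp only [ENat.toENNReal_eq_zero, encard_eq_zero, eq_empty_iff_forall_notMem, mem_inter_iff,
    not_and]
  exact ⟨fun h x hx hB => h x hB hx, fun h x hB hx => h x hx hB⟩

lemma counting_ne_zero_iff (S : PointConfig) (B : Set ℝ) :
    S.counting B ≠ 0 ↔ ∃ x ∈ S.points, x ∈ B := by
  rw [Ne, counting_eq_zero_iff]; push Not; rfl

lemma counting_shift (S : PointConfig) (s : ℝ) (B : Set ℝ) :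
    (S.shift s).counting B = S.counting ((fun x => x - s) ⁻¹' B) := by
  rw [counting_apply, counting_apply]
  congr 1
  rw [← (add_left_injective s).encard_image]
  congr 1
  ext x
  simp only [mem_image, mem_inter_iff, mem_preimage, shift, mem_ofPred_eq]
  constructor
  · rintro ⟨y, ⟨hB, hS⟩, rfl⟩
    simpa using ⟨hB, hS⟩
  · rintro ⟨hB, hS⟩
    exact ⟨x - s, by simpa using ⟨hB, hS⟩, by simp⟩

lemma shift_shift (S : PointConfig) (s t : ℝ) : (S.shift s).shift t = S.shift (t + s) := by
  ext x; simp [shift, add_assoc]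

lemma counting_Icc_lt_top (S : PointConfig) (a b : ℝ) : S.counting (Icc a b) < ∞ := by
  rw [counting_apply, inter_comm, ← (S.finite_inter a b).cast_ncard_eq]
  simp

@[fun_prop]
lemma measurable_counting : Measurable counting := comap_measurable _

lemma measurable_counting_apply {B : Set ℝ} (hB : MeasurableSet B) :
    Measurable fun S : PointConfig => S.counting B :=
  (Measure.measurable_coe hB).comp measurable_counting

lemma measurable_of_counting {α : Type*} [MeasurableSpace α] {g : α → PointConfig}
    (h : ∀ B : Set ℝ, MeasurableSet B → Measurable fun a => (g a).counting B) : Measurable g :=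
  measurable_comap_iff.2 (Measure.measurable_of_measurable_coe _ h)

/-- The counting measures of configurations, as a kernel. -/
noncomputable def countingKernel : Kernel PointConfig ℝ := ⟨counting, measurable_counting⟩

lemma countingKernel_apply (S : PointConfig) : countingKernel S = S.counting := rfl

/-- The counting kernel restricted to a unit interval and to the configurations with `m` points
there. -/
noncomputable def countingKernelPart (i : ℤ × ℕ) : Kernel PointConfig ℝ := by
  classical
  exact Kernel.piecewise
    (s := (fun S : PointConfig => S.counting (Ioc (i.1 : ℝ) (i.1 + 1))) ⁻¹' {(i.2 : ℝ≥0∞)})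
    (measurable_counting_apply measurableSet_Ioc (measurableSet_singleton _))
    (countingKernel.restrict (measurableSet_Ioc (a := (i.1 : ℝ)) (b := i.1 + 1))) 0

instance (i : ℤ × ℕ) : IsFiniteKernel (countingKernelPart i) := by
  classical
  refine ⟨⟨i.2, by simp, fun S => ?_⟩⟩
  rw [countingKernelPart, Kernel.piecewise_apply]
  split_ifs with h
  · rw [Kernel.restrict_apply, Measure.restrict_apply_univ, countingKernel_apply]
    exact le_of_eq h
  · simp

lemma counting_eq_tsum (S : PointConfig) {B : Set ℝ} (hB : MeasurableSet B) :
    S.counting B = ∑' k : ℤ, S.counting (B ∩ Ioc (k : ℝ) (k + 1)) := by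
  rw [← measure_iUnion _ fun k => hB.inter measurableSet_Ioc, ← inter_iUnion,
    iUnion_Ioc_intCast, inter_univ]
  intro k l hkl
  refine ((pairwise_disjoint_Ioc_intCast ℝ) hkl).mono ?_ ?_ <;> exact inter_subset_right

/-- The number of points in a bounded interval is finite but not bounded uniformly over
configurations. Splitting also according to that number makes every piece a finite kernel, so the
counting kernel is s-finite and Fubini applies to it. -/
lemma countingKernel_eq_sum : countingKernel = Kernel.sum countingKernelPart := by
  classical
  ext S B hB
  rw [Kernel.sum_apply' _ _ hB, countingKernel_apply, counting_eq_tsum S hB,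
    ENNReal.tsum_prod (f := fun k m => countingKernelPart (k, m) S B)]
  refine tsum_congr fun k => ?_
  obtain ⟨m, hm⟩ : ∃ m : ℕ, S.counting (Ioc (k : ℝ) (k + 1)) = (m : ℝ≥0∞) := by
    have := (measure_mono Ioc_subset_Icc_self).trans_lt (S.counting_Icc_lt_top k (k + 1))
    rw [counting_apply] at this ⊢
    have h2 : (Ioc (k : ℝ) (k + 1) ∩ S.points).encard ≠ ⊤ := by
      intro h; simp [h] at this
    exact ⟨(Ioc (k : ℝ) (k + 1) ∩ S.points).encard.toNat, by
      conv_lhs => rw [← ENat.natCast_toNat h2]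
      simp⟩
  rw [tsum_eq_single m]
  · rw [countingKernelPart, Kernel.piecewise_apply, if_pos (by exact hm), Kernel.restrict_apply,
      Measure.restrict_apply hB, countingKernel_apply]
  · intro l hl
    rw [countingKernelPart, Kernel.piecewise_apply, if_neg]
    · simp
    · simp only [mem_preimage, mem_singleton_iff, hm]
      exact fun h => hl (by exact_mod_cast h.symm)

instance : IsSFiniteKernel countingKernel := by
  rw [countingKernel_eq_sum]; infer_instance

instance (S : PointConfig) : SFinite S.counting :=
  inferInstanceAs (SFinite (countingKernel S))

/-- Random sets of times, such as the times at which the shifted configuration has some property,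
are counted throughout. S-finiteness of the kernel makes all these counts measurable. -/
lemma measurable_counting_section {α : Type*} [MeasurableSpace α] {g : α → PointConfig}
    (hg : Measurable g) {D : Set (α × ℝ)} (hD : MeasurableSet D) :
    Measurable fun a => (g a).counting {s | (a, s) ∈ D} :=
  Kernel.measurable_kernel_prodMk_left (κ := countingKernel.comap g hg) hD

lemma measurable_shift : Measurable fun p : ℝ × PointConfig => p.2.shift p.1 := by
  refine measurable_of_counting fun B hB => ?_
  simp only [counting_shift]
  exact measurable_counting_section (g := fun p : ℝ × PointConfig => p.2) measurable_snd
    (D := {q | q.2 - q.1.1 ∈ B})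
    ((measurable_snd.sub (measurable_fst.comp measurable_fst)) hB)

/-! ### Campbell and Palm measures of stationary laws -/

/-- The Campbell measure of a law on configurations: the mean number of points `s` such that `s`,
together with the configuration seen from `s`, belongs to a given set. -/
noncomputable def campbell (μ : Measure PointConfig) : Measure (ℝ × PointConfig) :=
  (μ ⊗ₘ countingKernel).map fun p => (p.2, p.1.shift p.2)

lemma measurable_campbell_map :
    Measurable fun p : PointConfig × ℝ => (p.2, p.1.shift p.2) :=
  measurable_snd.prodMk (measurable_shift.comp measurable_swap)

lemma campbell_apply (μ : Measure PointConfig) [SFinite μ] {D : Set (ℝ × PointConfig)}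
    (hD : MeasurableSet D) :
    campbell μ D = ∫⁻ S, S.counting {s | (s, S.shift s) ∈ D} ∂μ := by
  rw [campbell, Measure.map_apply measurable_campbell_map hD,
    Measure.compProd_apply (measurable_campbell_map hD)]
  rfl

/-- The Palm measure of a law on configurations, not normalised. -/
noncomputable def palmMeasure (μ : Measure PointConfig) : Measure PointConfig :=
  ((campbell μ).restrict (Ioc 0 1 ×ˢ univ)).map Prod.snd

lemma palmMeasure_apply_campbell (μ : Measure PointConfig) {A : Set PointConfig}
    (hA : MeasurableSet A) : palmMeasure μ A = campbell μ (Ioc 0 1 ×ˢ A) := by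
  rw [palmMeasure, Measure.map_apply measurable_snd hA,
    Measure.restrict_apply (measurable_snd hA)]
  congr 1
  ext; simp; tauto

lemma palmMeasure_apply (μ : Measure PointConfig) [SFinite μ] {A : Set PointConfig}
    (hA : MeasurableSet A) :
    palmMeasure μ A = ∫⁻ S, S.counting {s | s ∈ Ioc (0 : ℝ) 1 ∧ S.shift s ∈ A} ∂μ := by
  rw [palmMeasure_apply_campbell μ hA, campbell_apply μ (measurableSet_Ioc.prod hA)]
  rfl

lemma palmMeasure_univ (μ : Measure PointConfig) [SFinite μ] :
    palmMeasure μ univ = ∫⁻ S, S.counting (Ioc 0 1) ∂μ := by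
  rw [palmMeasure_apply μ MeasurableSet.univ]
  simp only [mem_univ, and_true]
  rfl

/-- A law on configurations that is invariant under all time shifts. -/
def IsStationary (μ : Measure PointConfig) : Prop := ∀ s : ℝ, MeasurePreserving (shift s) μ μ

variable {μ : Measure PointConfig} [SFinite μ]

/-- Shifting the configuration by `a` moves each of its points by `-a` but does not change what is
seen from that point; stationarity absorbs the shift. -/
lemma IsStationary.campbell_prod_add (h : IsStationary μ) {A : Set PointConfig}
    (hA : MeasurableSet A) (a : ℝ) {B : Set ℝ} (hB : MeasurableSet B) :
    campbell μ (((fun x => a + x) ⁻¹' B) ×ˢ A) = campbell μ (B ×ˢ A) := by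
  have hB' : MeasurableSet ((fun x => a + x) ⁻¹' B) := measurable_const_add a hB
  rw [campbell_apply μ (hB'.prod hA), campbell_apply μ (hB.prod hA)]
  have hm : Measurable fun S : PointConfig =>
      S.counting {s | (s, S.shift s) ∈ ((fun x => a + x) ⁻¹' B) ×ˢ A} :=
    measurable_counting_section (g := fun S => S) measurable_id
      (measurable_campbell_map (hB'.prod hA))
  rw [← (h a).lintegral_comp hm]
  refine lintegral_congr fun S => ?_
  rw [counting_shift]
  congr 1
  ext s
  simp [shift_shift]

/-- For fixed `A`, the Campbell measure of `B ×ˢ A` is a translation-invariant, locally finite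
measure in `B`. By uniqueness of Haar measure it is a multiple of Lebesgue measure, and the interval
`(0, 1]` identifies the factor as the Palm mass of `A`. -/
lemma IsStationary.campbell_eq_prod (h : IsStationary μ)
    (hfin : ∫⁻ S, S.counting (Ioc 0 1) ∂μ ≠ ∞) :
    campbell μ = (volume : Measure ℝ).prod (palmMeasure μ) := by
  have hQ : IsFiniteMeasure (palmMeasure μ) := ⟨by rw [palmMeasure_univ]; exact hfin.lt_top⟩
  symm
  refine Measure.prod_eq fun B A hB hA => ?_
  let ρ : Measure ℝ := ((campbell μ).restrict (univ ×ˢ A)).map Prod.fst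
  have hρ : ∀ B : Set ℝ, MeasurableSet B → ρ B = campbell μ (B ×ˢ A) := fun B hB => by
    rw [Measure.map_apply measurable_fst hB, Measure.restrict_apply (measurable_fst hB)]
    congr 1
    ext; simp
  have hinv : ρ.IsAddLeftInvariant := by
    refine ⟨fun a => ?_⟩
    ext B hB
    rw [Measure.map_apply (measurable_const_add a) hB, hρ _ hB,
      hρ _ (measurable_const_add a hB), h.campbell_prod_add hA a hB]
  have h1 : ρ (Ioc 0 1) = palmMeasure μ A := by
    rw [hρ _ measurableSet_Ioc, palmMeasure_apply_campbell μ hA]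
  have hunit : ∀ k : ℤ, ρ (Ioc (k : ℝ) (k + 1)) < ∞ := fun k => by
    have := measure_preimage_add ρ (-(k : ℝ)) (Ioc 0 1)
    have h2 : (fun x => -(k : ℝ) + x) ⁻¹' (Ioc 0 1) = Ioc (k : ℝ) (k + 1) := by
      ext x
      simp only [mem_preimage, mem_Ioc]
      constructor <;> rintro ⟨h1, h2⟩ <;> constructor <;> linarith
    rw [h2, h1] at this
    rw [this]
    exact measure_lt_top _ _
  have hloc : IsLocallyFiniteMeasure ρ := by
    refine ⟨fun x => ⟨Ioo ((⌈x⌉ : ℝ) - 1) (⌈x⌉ + 1), Ioo_mem_nhds ?_ ?_, ?_⟩⟩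
    · linarith [Int.ceil_lt_add_one x]
    · linarith [Int.le_ceil x]
    · have hsub : Ioo ((⌈x⌉ : ℝ) - 1) (⌈x⌉ + 1) ⊆
          Ioc (((⌈x⌉ - 1 : ℤ) : ℝ)) (((⌈x⌉ - 1 : ℤ) : ℝ) + 1) ∪ Ioc (⌈x⌉ : ℝ) (⌈x⌉ + 1) := by
        intro y hy
        rcases le_or_gt y ⌈x⌉ with h | h
        · left; push_cast; exact ⟨hy.1, by linarith⟩
        · right; exact ⟨h, hy.2.le⟩
      exact (measure_mono hsub).trans_lt
        ((measure_union_le _ _).trans_lt (ENNReal.add_lt_top.2 ⟨hunit _, hunit _⟩))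
  have key := Measure.isAddLeftInvariant_eq_smul ρ (volume : Measure ℝ)
  generalize ρ.addHaarScalarFactor (volume : Measure ℝ) = c at key
  rw [← hρ B hB, ← h1, key]
  rw [Measure.smul_apply, Measure.smul_apply, Real.volume_Ioc, ENNReal.smul_def, ENNReal.smul_def,
    smul_eq_mul, smul_eq_mul, mul_comm]
  simp

/-- The refined Campbell formula of a stationary law. -/
theorem IsStationary.lintegral_counting_shift (h : IsStationary μ)
    (hfin : ∫⁻ S, S.counting (Ioc 0 1) ∂μ ≠ ∞) {D : Set (ℝ × PointConfig)}
    (hD : MeasurableSet D) :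
    ∫⁻ S, S.counting {s | (s, S.shift s) ∈ D} ∂μ
      = ∫⁻ s, palmMeasure μ {S | (s, S) ∈ D} := by
  have hQ : IsFiniteMeasure (palmMeasure μ) := ⟨by rw [palmMeasure_univ]; exact hfin.lt_top⟩
  rw [← campbell_apply μ hD, h.campbell_eq_prod hfin, Measure.prod_apply hD]
  rfl

end PointConfig

/-! ### Palm–Khinchin formulas: forward and backward recurrence times -/

/-- Two antitone functions with the same integrals over all `[0, t]` agree on `(0, ∞)` if one of
them is continuous. -/
lemma eq_of_antitone_of_integral_eq {V W : ℝ → ℝ} (hV : Antitone V) (hW : Antitone W)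
    (hVc : Continuous V) (h : ∀ t, 0 ≤ t → ∫ u in (0 : ℝ)..t, V u = ∫ u in (0 : ℝ)..t, W u)
    {t : ℝ} (ht : 0 < t) : W t = V t := by
  have hVi : ∀ a b, IntervalIntegrable V volume a b := fun a b => hVc.intervalIntegrable a b
  have hWi : ∀ a b, IntervalIntegrable W volume a b := fun a b => hW.intervalIntegrable
  have key : ∀ a b, 0 ≤ a → a ≤ b → ∫ u in a..b, V u = ∫ u in a..b, W u := by
    intro a b ha hab
    rw [← intervalIntegral.integral_interval_sub_left (hVi 0 b) (hVi 0 a),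
      ← intervalIntegral.integral_interval_sub_left (hWi 0 b) (hWi 0 a), h b (ha.trans hab), h a ha]
  have upper : ∀ {U : ℝ → ℝ}, Antitone U → ∀ a b, a ≤ b →
      ∫ u in a..b, U u ≤ (b - a) * U a := fun {U} hU a b hab => by
    have := intervalIntegral.integral_mono_on hab hU.intervalIntegrable
      (intervalIntegrable_const (c := U a) (μ := volume)) (fun x hx => hU hx.1)
    simpa using this
  have lower : ∀ {U : ℝ → ℝ}, Antitone U → ∀ a b, a ≤ b →
      (b - a) * U b ≤ ∫ u in a..b, U u := fun {U} hU a b hab => by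
    have := intervalIntegral.integral_mono_on hab
      (intervalIntegrable_const (c := U b) (μ := volume)) hU.intervalIntegrable (fun x hx => hU hx.2)
    simpa using this
  -- The common mean over `[a, b]` lies between the end values of either function. Letting one end
  -- tend to `t` then uses continuity of `V` alone.
  have le : ∀ a b, 0 ≤ a → a < b → W b ≤ V a ∧ V b ≤ W a := fun a b ha hab => by
    have hba : 0 < b - a := sub_pos.2 hab
    have hk := key a b ha hab.le
    refine ⟨le_of_mul_le_mul_left ?_ hba, le_of_mul_le_mul_left ?_ hba⟩
    · exact (lower hW a b hab.le).trans (hk ▸ upper hV a b hab.le)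
    · exact (lower hV a b hab.le).trans (hk ▸ upper hW a b hab.le)
  refine le_antisymm ?_ ?_
  · have : Tendsto V (𝓝[<] t) (𝓝 (V t)) := hVc.continuousAt.tendsto.mono_left nhdsWithin_le_nhds
    refine ge_of_tendsto this ?_
    filter_upwards [Ioo_mem_nhdsLT ht] with a ha using (le a t ha.1.le ha.2).1
  · have : Tendsto V (𝓝[>] t) (𝓝 (V t)) := hVc.continuousAt.tendsto.mono_left nhdsWithin_le_nhds
    refine le_of_tendsto this ?_
    filter_upwards [self_mem_nhdsWithin] with a ha using (le t a ht.le ha).2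

namespace PointConfig

/-- A configuration has one last point in `[a, b]` if it has any there. -/
lemma counting_last (S : PointConfig) (a b : ℝ) :
    S.counting {s | s ∈ Icc a b ∧ S.counting (Ioc s b) = 0}
      = indicator {S : PointConfig | S.counting (Icc a b) ≠ 0} 1 S := by
  by_cases h : S.counting (Icc a b) ≠ 0
  · rw [indicator_of_mem (by exact h), counting_apply]
    obtain ⟨x, hx, hxI⟩ := (counting_ne_zero_iff _ _).1 h
    obtain ⟨m, ⟨hm, hmI⟩, hmax⟩ := exists_max_image _ id (S.finite_inter a b) ⟨x, hx, hxI⟩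
    have : {s | s ∈ Icc a b ∧ S.counting (Ioc s b) = 0} ∩ S.points = {m} := by
      ext y
      simp only [mem_inter_iff, mem_ofPred_eq, mem_singleton_iff, counting_eq_zero_iff]
      constructor
      · rintro ⟨⟨hyI, hy0⟩, hy⟩
        refine le_antisymm (hmax y ⟨hy, hyI⟩) (not_lt.1 fun hlt => hy0 m hm ⟨hlt, hmI.2⟩)
      · rintro rfl
        exact ⟨⟨hmI, fun z hz hzI =>
          absurd (hmax z ⟨hz, hmI.1.trans hzI.1.le, hzI.2⟩) (not_le.2 hzI.1)⟩, hm⟩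
    rw [this]; simp
  · rw [indicator_of_notMem (by exact h)]
    rw [not_not] at h
    exact measure_mono_null (fun s hs => hs.1) h

/-- A configuration has one first point in `[a, b]` if it has any there. -/
lemma counting_first (S : PointConfig) (a b : ℝ) :
    S.counting {s | s ∈ Icc a b ∧ S.counting (Ico a s) = 0}
      = indicator {S : PointConfig | S.counting (Icc a b) ≠ 0} 1 S := by
  by_cases h : S.counting (Icc a b) ≠ 0
  · rw [indicator_of_mem (by exact h), counting_apply]
    obtain ⟨x, hx, hxI⟩ := (counting_ne_zero_iff _ _).1 h
    obtain ⟨m, ⟨hm, hmI⟩, hmin⟩ := exists_min_image _ id (S.finite_inter a b) ⟨x, hx, hxI⟩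
    have : {s | s ∈ Icc a b ∧ S.counting (Ico a s) = 0} ∩ S.points = {m} := by
      ext y
      simp only [mem_inter_iff, mem_ofPred_eq, mem_singleton_iff, counting_eq_zero_iff]
      constructor
      · rintro ⟨⟨hyI, hy0⟩, hy⟩
        refine le_antisymm (not_lt.1 fun hlt => hy0 m hm ⟨hmI.1, hlt⟩) (hmin y ⟨hy, hyI⟩)
      · rintro rfl
        exact ⟨⟨hmI, fun z hz hzI =>
          absurd (hmin z ⟨hz, hzI.1, hzI.2.le.trans hmI.2⟩) (not_le.2 hzI.2)⟩, hm⟩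
    rw [this]; simp
  · rw [indicator_of_notMem (by exact h)]
    rw [not_not] at h
    exact measure_mono_null (fun s hs => hs.1) h

lemma measurableSet_counting_eq_zero {B : Set ℝ} (hB : MeasurableSet B) :
    MeasurableSet {S : PointConfig | S.counting B = 0} :=
  measurable_counting_apply hB (measurableSet_singleton 0)

lemma measurableSet_counting_ne_zero {B : Set ℝ} (hB : MeasurableSet B) :
    MeasurableSet {S : PointConfig | S.counting B ≠ 0} :=
  (measurableSet_counting_eq_zero hB).compl

namespace IsStationary

variable {μ : Measure PointConfig}

lemma measure_counting_shift (h : IsStationary μ) (s : ℝ) {B : Set ℝ} (hB : MeasurableSet B) :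
    μ {S | S.counting ((fun x => x - s) ⁻¹' B) ≠ 0} = μ {S | S.counting B ≠ 0} := by
  rw [← (h s).measure_preimage (measurableSet_counting_ne_zero hB).nullMeasurableSet]
  simp only [preimage_ofPred_eq, counting_shift]

variable [IsProbabilityMeasure μ]

/-- By Campbell's formula the mean number of points at `x` is the integral of the Palm mass over the
Lebesgue-null set `{x}`. -/
lemma lintegral_counting_singleton (h : IsStationary μ)
    (hfin : ∫⁻ S, S.counting (Ioc 0 1) ∂μ ≠ ∞) (x : ℝ) :
    ∫⁻ S, S.counting {x} ∂μ = 0 := by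
  have := h.lintegral_counting_shift hfin (D := {x} ×ˢ univ)
    ((measurableSet_singleton x).prod MeasurableSet.univ)
  simp only [mem_prod, mem_singleton_iff, mem_univ, and_true] at this
  rw [show ({x} : Set ℝ) = {s | s = x} from rfl, this]
  have h0 : (fun s : ℝ => palmMeasure μ {S | s = x}) =ᵐ[volume] 0 := by
    filter_upwards [Measure.ae_ne volume x] with s hs
    simp [hs]
  rw [lintegral_congr_ae h0]; simp

/-- If the interval has a point, exactly one point `s` of it is the last one, so the probability is
the mean number of such points. Seen from `s`, being last means having no point in `(0, -s]`, and
Campbell's formula applies. -/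
lemma measure_counting_Icc_eq_last (h : IsStationary μ)
    (hfin : ∫⁻ S, S.counting (Ioc 0 1) ∂μ ≠ ∞) (t : ℝ) :
    μ {S | S.counting (Icc (-t) 0) ≠ 0}
      = ∫⁻ s in Icc (-t) 0, palmMeasure μ {S | S.counting (Ioc 0 (-s)) = 0} := by
  have hm : MeasurableSet {p : ℝ × PointConfig | p.2.counting (Ioc 0 (-p.1)) = 0} := by
    refine measurable_counting_section (g := fun p : ℝ × PointConfig => p.2) measurable_snd
      (D := {q | 0 < q.2 ∧ q.2 ≤ -q.1.1}) ?_ (measurableSet_singleton 0)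
    exact (measurableSet_lt measurable_const measurable_snd).inter
      (measurableSet_le measurable_snd measurable_fst.fst.neg)
  have hD : MeasurableSet {p : ℝ × PointConfig |
      p.1 ∈ Icc (-t) 0 ∧ p.2.counting (Ioc 0 (-p.1)) = 0} :=
    (measurable_fst measurableSet_Icc).inter hm
  have key := h.lintegral_counting_shift hfin hD
  have e : ∀ S : PointConfig, ∀ s : ℝ,
      (S.shift s).counting (Ioc 0 (-s)) = S.counting (Ioc s 0) := fun S s => by
    rw [counting_shift]; congr 1; ext x; simp
  simp only [mem_ofPred_eq, e, counting_last] at key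
  rw [lintegral_indicator_one (measurableSet_counting_ne_zero measurableSet_Icc)] at key
  rw [key, ← lintegral_indicator measurableSet_Icc]
  refine lintegral_congr fun s => ?_
  by_cases hs : s ∈ Icc (-t) 0
  · rw [indicator_of_mem hs]; simp only [hs, true_and]
  · rw [indicator_of_notMem hs]; simp only [hs, false_and]; simp

/-- The same decomposition according to the first point, which involves the past of that point
instead of its future. -/
lemma measure_counting_Icc_eq_first (h : IsStationary μ)
    (hfin : ∫⁻ S, S.counting (Ioc 0 1) ∂μ ≠ ∞) (t : ℝ) :
    μ {S | S.counting (Icc 0 t) ≠ 0}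
      = ∫⁻ s in Icc 0 t, palmMeasure μ {S | S.counting (Ico (-s) 0) = 0} := by
  have hm : MeasurableSet {p : ℝ × PointConfig | p.2.counting (Ico (-p.1) 0) = 0} := by
    refine measurable_counting_section (g := fun p : ℝ × PointConfig => p.2) measurable_snd
      (D := {q | -q.1.1 ≤ q.2 ∧ q.2 < 0}) ?_ (measurableSet_singleton 0)
    exact (measurableSet_le measurable_fst.fst.neg measurable_snd).inter
      (measurableSet_lt measurable_snd measurable_const)
  have hD : MeasurableSet {p : ℝ × PointConfig |
      p.1 ∈ Icc 0 t ∧ p.2.counting (Ico (-p.1) 0) = 0} :=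
    (measurable_fst measurableSet_Icc).inter hm
  have key := h.lintegral_counting_shift hfin hD
  have e : ∀ S : PointConfig, ∀ s : ℝ,
      (S.shift s).counting (Ico (-s) 0) = S.counting (Ico 0 s) := fun S s => by
    rw [counting_shift]; congr 1; ext x; simp
  simp only [mem_ofPred_eq, e, counting_first] at key
  rw [lintegral_indicator_one (measurableSet_counting_ne_zero measurableSet_Icc)] at key
  rw [key, ← lintegral_indicator measurableSet_Icc]
  refine lintegral_congr fun s => ?_
  by_cases hs : s ∈ Icc 0 t
  · rw [indicator_of_mem hs]; simp only [hs, true_and]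
  · rw [indicator_of_notMem hs]; simp only [hs, false_and]; simp

lemma measure_counting_Ico_eq_Icc (h : IsStationary μ)
    (hfin : ∫⁻ S, S.counting (Ioc 0 1) ∂μ ≠ ∞) {t : ℝ} (ht : 0 ≤ t) :
    μ {S | S.counting (Ico (-t) 0) ≠ 0} = μ {S | S.counting (Icc (-t) 0) ≠ 0} := by
  have h0 : ∀ᵐ S ∂μ, S.counting {0} = 0 :=
    (lintegral_eq_zero_iff (measurable_counting_apply (measurableSet_singleton 0))).1
      (h.lintegral_counting_singleton hfin 0)
  refine measure_congr ?_
  filter_upwards [h0] with S hS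
  refine propext (not_congr ?_)
  rw [← Ico_union_right (neg_nonpos.2 ht), measure_union_null_iff]
  exact ⟨fun h => ⟨h, hS⟩, fun h => h.1⟩

/-- The last point of the window yields the forward recurrence time and the first point the backward
one. As both formulas describe the same probability, the two tails have the same primitive. -/
lemma real_measure_counting_Ico_eq (h : IsStationary μ)
    (hfin : ∫⁻ S, S.counting (Ioc 0 1) ∂μ ≠ ∞) {t : ℝ} (ht : 0 ≤ t) :
    μ.real {S | S.counting (Ico (-t) 0) ≠ 0}
        = ∫ u in (0 : ℝ)..t, (palmMeasure μ).real {S | S.counting (Ioc 0 u) = 0} ∧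
    μ.real {S | S.counting (Ico (-t) 0) ≠ 0}
        = ∫ u in (0 : ℝ)..t, (palmMeasure μ).real {S | S.counting (Ico (-u) 0) = 0} := by
  have hQ : IsFiniteMeasure (palmMeasure μ) := ⟨by rw [palmMeasure_univ]; exact hfin.lt_top⟩
  have h1 : Antitone fun u : ℝ => (palmMeasure μ).real {S | S.counting (Ioc 0 u) = 0} :=
    fun u v huv => measureReal_mono fun S hS => measure_mono_null (Ioc_subset_Ioc_right huv) hS
  have h2 : Antitone fun u : ℝ => (palmMeasure μ).real {S | S.counting (Ico (-u) 0) = 0} :=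
    fun u v huv => measureReal_mono fun S hS =>
      measure_mono_null (Ico_subset_Ico_left (neg_le_neg huv)) hS
  have conv : ∀ {V : ℝ → Set PointConfig}, Antitone (fun u => (palmMeasure μ).real (V u)) →
      (∫⁻ u in Icc 0 t, palmMeasure μ (V u)).toReal
        = ∫ u in (0 : ℝ)..t, (palmMeasure μ).real (V u) := fun {V} hV => by
    rw [intervalIntegral.integral_of_le ht, ← integral_Icc_eq_integral_Ioc,
      integral_eq_lintegral_of_nonneg_ae (ae_of_all _ fun _ => measureReal_nonneg)
        hV.measurable.aestronglyMeasurable]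
    simp
  constructor
  · rw [measureReal_def, h.measure_counting_Ico_eq_Icc hfin ht,
      h.measure_counting_Icc_eq_last hfin, ← conv h1]
    congr 1
    -- Reflection `s ↦ -s` turns the integral over `[-t, 0]` into one over `[0, t]`.
    have hmp := (Measure.measurePreserving_neg (volume : Measure ℝ)).setLIntegral_comp_preimage_emb
      (MeasurableEquiv.neg ℝ).measurableEmbedding
      (fun u => palmMeasure μ {S | S.counting (Ioc 0 u) = 0}) (Icc 0 t)
    rw [← hmp]
    congr 2
    ext x
    simp
  · rw [measureReal_def, h.measure_counting_Ico_eq_Icc hfin ht, ← conv h2,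
      ← h.measure_counting_Icc_eq_first hfin, ← h.measure_counting_shift t measurableSet_Icc]
    congr 4
    ext S
    rw [show (fun x => x - t) ⁻¹' Icc (-t) 0 = Icc 0 t by ext x; simp]

/-- Under the Palm measure, the backward and the forward recurrence times have the same law. -/
theorem palmMeasure_backward_eq_forward (h : IsStationary μ)
    (hfin : ∫⁻ S, S.counting (Ioc 0 1) ∂μ ≠ ∞)
    (hc : Continuous fun u : ℝ => (palmMeasure μ).real {S | S.counting (Ioc 0 u) = 0})
    {t : ℝ} (ht : 0 < t) :
    (palmMeasure μ).real {S | S.counting (Ico (-t) 0) = 0}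
      = (palmMeasure μ).real {S | S.counting (Ioc 0 t) = 0} := by
  have hQ : IsFiniteMeasure (palmMeasure μ) := ⟨by rw [palmMeasure_univ]; exact hfin.lt_top⟩
  have h1 : Antitone fun u : ℝ => (palmMeasure μ).real {S | S.counting (Ioc 0 u) = 0} :=
    fun u v huv => measureReal_mono fun S hS => measure_mono_null (Ioc_subset_Ioc_right huv) hS
  have h2 : Antitone fun u : ℝ => (palmMeasure μ).real {S | S.counting (Ico (-u) 0) = 0} :=
    fun u v huv => measureReal_mono fun S hS =>
      measure_mono_null (Ico_subset_Ico_left (neg_le_neg huv)) hS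
  refine eq_of_antitone_of_integral_eq h1 h2 hc (fun t ht => ?_) ht
  obtain ⟨e1, e2⟩ := h.real_measure_counting_Ico_eq hfin ht
  exact e1.symm.trans e2

end IsStationary

end PointConfig

/-! ### Comparing the eviction time with a fixed time -/

section Deterministic

variable {ι : Type*}

lemma requested_mono (ξ : ι → PointConfig) (i : ι) : Monotone (requested ξ i) := by
  intro t u htu
  unfold requested
  split_ifs with h1 h2
  · exact le_rfl
  · obtain ⟨x, hx, hx0, hxt⟩ := h1
    exact absurd ⟨x, hx, hx0, hxt.trans htu⟩ h2
  · exact Nat.zero_le _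
  · exact le_rfl

lemma requested_le_one (ξ : ι → PointConfig) (i : ι) (t : ℝ≥0∞) : requested ξ i t ≤ 1 := by
  unfold requested; split_ifs <;> simp

variable [Fintype ι]

lemma numRequested_mono (ξ : ι → PointConfig) : Monotone (numRequested ξ) :=
  fun _ _ h => Finset.sum_le_sum fun i _ => requested_mono ξ i h

lemma requested_eq_one_of_evictionTime {C : ℕ} {ξ : ι → PointConfig} {i : ι} {t : ℝ≥0∞}
    (hC : C ≤ numRequested ξ t) (h : requested ξ i (evictionTime C ξ) = 1) :
    requested ξ i t = 1 :=
  le_antisymm (requested_le_one _ _ _) (h ▸ requested_mono ξ i (sInf_le hC))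

/-- Every time at which `C` contents have been requested is at least `t`, by monotonicity of the
count. As in the opposite comparison, only the order properties of the infimum enter, so it need not
be attained. -/
lemma requested_evictionTime_eq_one {C : ℕ} {ξ : ι → PointConfig} {i : ι} {t : ℝ≥0∞}
    (hC : numRequested ξ t < C) (h : requested ξ i t = 1) :
    requested ξ i (evictionTime C ξ) = 1 := by
  refine le_antisymm (requested_le_one _ _ _) (h ▸ requested_mono ξ i (le_sInf fun u hu => ?_))
  by_contra! hlt
  exact absurd (hu.trans (numRequested_mono ξ hlt.le)) (not_le.2 hC)

end Deterministic

/-! ### Indicators of a request in a window -/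

namespace PointConfig

/-- The indicator of the presence of points in `[s - t, s)`. -/
noncomputable def visits (S : PointConfig) (t s : ℝ) : ℝ :=
  indicator {S : PointConfig | S.counting (Ico (s - t) s) ≠ 0} 1 S

lemma visits_nonneg (S : PointConfig) (t s : ℝ) : 0 ≤ S.visits t s :=
  indicator_nonneg (fun _ _ => zero_le_one) _

lemma visits_le_one (S : PointConfig) (t s : ℝ) : S.visits t s ≤ 1 :=
  indicator_le_self' (fun _ _ => zero_le_one) _

lemma requested_shift_eq_one_iff {ι : Type*} (ξ : ι → PointConfig) (i : ι) {t : ℝ} (ht : 0 ≤ t)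
    (s : ℝ) : requested (fun i => (ξ i).shift s) i (ENNReal.ofReal t) = 1 ↔
      (ξ i).counting (Ico (s - t) s) ≠ 0 := by
  rw [counting_ne_zero_iff, requested]
  simp only [ENNReal.ofReal_le_ofReal_iff ht, ite_eq_left_iff, zero_ne_one, imp_false, not_not]
  constructor
  · rintro ⟨x, hx, hx0, hxt⟩
    exact ⟨x + s, hx, by constructor <;> linarith⟩
  · rintro ⟨x, hx, hx1, hx2⟩
    exact ⟨x - s, by simpa [shift] using hx, by linarith, by linarith⟩

lemma requested_shift_eq_visits {ι : Type*} (ξ : ι → PointConfig) (i : ι) {t : ℝ} (ht : 0 ≤ t)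
    (s : ℝ) : (requested (fun i => (ξ i).shift s) i (ENNReal.ofReal t) : ℝ)
      = (ξ i).visits t s := by
  have h := requested_shift_eq_one_iff ξ i ht s
  unfold visits
  by_cases hc : (ξ i).counting (Ico (s - t) s) ≠ 0
  · rw [indicator_of_mem (by exact hc), h.2 hc]; simp
  · rw [indicator_of_notMem (by exact hc)]
    have h1 := requested_le_one (fun i => (ξ i).shift s) i (ENNReal.ofReal t)
    have h2 : requested (fun i => (ξ i).shift s) i (ENNReal.ofReal t) ≠ 1 := fun h' => hc (h.1 h')
    have : requested (fun i => (ξ i).shift s) i (ENNReal.ofReal t) = 0 := by omega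
    simp [this]

lemma measurableSet_counting_Ico {α : Type*} [MeasurableSpace α] {g : α → PointConfig}
    (hg : Measurable g) {a b : α → ℝ} (ha : Measurable a) (hb : Measurable b) :
    MeasurableSet {x | (g x).counting (Ico (a x) (b x)) ≠ 0} := by
  refine (measurable_counting_section hg (D := {q | a q.1 ≤ q.2 ∧ q.2 < b q.1}) ?_
    (measurableSet_singleton 0)).compl
  exact (measurableSet_le (ha.comp measurable_fst) measurable_snd).inter
    (measurableSet_lt measurable_snd (hb.comp measurable_fst))

lemma measurable_visits {α : Type*} [MeasurableSpace α] {g : α → PointConfig}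
    (hg : Measurable g) (t : ℝ) {b : α → ℝ} (hb : Measurable b) :
    Measurable fun x => (g x).visits t (b x) :=
  (measurable_const (a := (1 : ℝ))).indicator
    (measurableSet_counting_Ico hg (hb.sub_const t) hb)

lemma integral_visits {μ : Measure PointConfig} (t s : ℝ) :
    ∫ S, S.visits t s ∂μ = μ.real {S | S.counting (Ico (s - t) s) ≠ 0} :=
  integral_indicator_one (measurableSet_counting_ne_zero measurableSet_Ico)

end PointConfig

open PointConfig

/-! ### Independent processes and inter-request distributions -/

section Family

variable {Ω : Type*} [MeasurableSpace Ω] {P : Measure Ω}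

lemma IsStationaryErgodic.isStationary {N : Ω → PointConfig} (h : IsStationaryErgodic P N) :
    IsStationary (P.map N) := h.stationary

lemma intensity_eq_lintegral_map {N : Ω → PointConfig} (hN : Measurable N) :
    intensity P N = ∫⁻ S, S.counting (Ioc 0 1) ∂(P.map N) := by
  rw [lintegral_map (measurable_counting_apply measurableSet_Ioc) hN]; rfl

variable [IsProbabilityMeasure P]

/-- Fubini for the points of a process and an independent random element. -/
lemma lintegral_counting_le_of_indepFun {β : Type*} [MeasurableSpace β] {N : Ω → PointConfig}
    {Y : Ω → β} (hN : Measurable N) (hY : Measurable Y) (h : IndepFun N Y P)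
    {D : Set (β × ℝ)} (hD : MeasurableSet D) {I : Set ℝ} (hI : MeasurableSet I) {ε : ℝ≥0∞}
    (hε : ∀ s ∈ I, P {ω | (Y ω, s) ∈ D} ≤ ε) :
    ∫⁻ ω, (N ω).counting {s | s ∈ I ∧ (Y ω, s) ∈ D} ∂P ≤ ε * ∫⁻ ω, (N ω).counting I ∂P := by
  have hNY := (indepFun_iff_map_prod_eq_prod_map_map hN.aemeasurable hY.aemeasurable).1 h
  have hE : MeasurableSet {q : β × ℝ | q.2 ∈ I ∧ q ∈ D} := (measurable_snd hI).inter hD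
  have hm : Measurable fun p : PointConfig × β => p.1.counting {s | s ∈ I ∧ (p.2, s) ∈ D} :=
    measurable_counting_section (g := fun p : PointConfig × β => p.1) measurable_fst
      (D := {q | q.2 ∈ I ∧ (q.1.2, q.2) ∈ D})
      ((measurable_snd hI).inter ((measurable_fst.snd.prodMk measurable_snd) hD))
  have e := lintegral_map (μ := P) hm (hN.prodMk hY)
  rw [← e, hNY]
  have hp : IsProbabilityMeasure (P.map Y) := Measure.isProbabilityMeasure_map hY.aemeasurable
  have hp' : IsProbabilityMeasure (P.map N) := Measure.isProbabilityMeasure_map hN.aemeasurable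
  rw [lintegral_prod _ hm.aemeasurable,
    ← lintegral_map (μ := P) (measurable_counting_apply hI) hN,
    ← lintegral_const_mul _ (measurable_counting_apply hI)]
  -- With the configuration of `N` frozen, independence leaves the law of `Y` unchanged, and the sum
  -- over the points can be exchanged with the expectation over `Y`.
  refine lintegral_mono fun S => ?_
  have e1 := Measure.prod_apply (μ := P.map Y) (ν := S.counting) hE
  have e2 := Measure.prod_apply_symm (μ := P.map Y) (ν := S.counting) hE
  calc ∫⁻ y, S.counting {s | s ∈ I ∧ (y, s) ∈ D} ∂(P.map Y)
      = ∫⁻ s, (P.map Y) {y | s ∈ I ∧ (y, s) ∈ D} ∂S.counting := e1.symm.trans e2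
    _ ≤ ∫⁻ s, indicator I (fun _ => ε) s ∂S.counting := by
        refine lintegral_mono fun s => ?_
        by_cases hs : s ∈ I
        · rw [indicator_of_mem hs]
          simp only [hs, true_and]
          exact (Measure.map_apply hY (measurable_prodMk_right hD)).trans_le (hε s hs)
        · simp [hs]
    _ = ε * S.counting I := by rw [lintegral_indicator hI]; simp

variable {ι : Type*}

lemma lintegral_counting_shift_eq_palmMeasure {N : Ω → PointConfig} (hN : Measurable N)
    {A : Set PointConfig} (hA : MeasurableSet A) :
    ∫⁻ ω, (N ω).counting {s | s ∈ Ioc (0 : ℝ) 1 ∧ (N ω).shift s ∈ A} ∂P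
      = palmMeasure (P.map N) A := by
  have hp' : IsProbabilityMeasure (P.map N) := Measure.isProbabilityMeasure_map hN.aemeasurable
  rw [palmMeasure_apply _ hA, lintegral_map _ hN]
  exact measurable_counting_section (g := fun S => S) measurable_id
      (measurable_campbell_map (measurableSet_Ioc.prod hA))

variable (R : ι → Ω → PointConfig)

lemma real_palmMeasure_Ioc {i : ι} (hN : Measurable (R i))
    (hrate : 0 < intensity P (R i) ∧ intensity P (R i) < ∞) (t : ℝ) :
    (palmMeasure (P.map (R i))).real {S | S.counting (Ioc 0 t) = 0}
      = rate P R i * (1 - interRequestCdf P R i t) := by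
  have hp' : IsProbabilityMeasure (P.map (R i)) :=
    Measure.isProbabilityMeasure_map hN.aemeasurable
  have hQu : palmMeasure (P.map (R i)) univ = intensity P (R i) := by
    rw [palmMeasure_univ, intensity_eq_lintegral_map hN]
  have hQ : IsFiniteMeasure (palmMeasure (P.map (R i))) := ⟨by rw [hQu]; exact hrate.2⟩
  have hpos : 0 < rate P R i := ENNReal.toReal_pos hrate.1.ne' hrate.2.ne
  have hG : interRequestCdf P R i t
      = (palmMeasure (P.map (R i))).real {S | S.counting (Ioc 0 t) ≠ 0} / rate P R i := by
    rw [interRequestCdf, palmProb, ENNReal.toReal_div, measureReal_def,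
      ← lintegral_counting_shift_eq_palmMeasure hN
        (measurableSet_counting_ne_zero measurableSet_Ioc)]
    simp only [mem_ofPred_eq, counting_ne_zero_iff, mem_Ioc]
    rfl
  rw [hG, mul_sub, mul_one, mul_div_cancel₀ _ hpos.ne']
  have := measureReal_compl (μ := palmMeasure (P.map (R i)))
    (measurableSet_counting_ne_zero (measurableSet_Ioc (a := (0 : ℝ)) (b := t)))
  rw [measureReal_def (s := univ), hQu] at this
  rw [rate, ← this]
  congr 1
  ext S; simp

/-- A hit depends on the previous request, while `interRequestCdf` concerns the next one. Equality
in law of the two recurrence times, which uses continuity, connects them. -/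
lemma real_palmMeasure_Ico {i : ι} (hN : IsStationaryErgodic P (R i))
    (hrate : 0 < intensity P (R i) ∧ intensity P (R i) < ∞)
    (hc : Continuous (interRequestCdf P R i)) {t : ℝ} (ht : 0 < t) :
    (palmMeasure (P.map (R i))).real {S | S.counting (Ico (-t) 0) ≠ 0}
      = rate P R i * interRequestCdf P R i t := by
  have hp' : IsProbabilityMeasure (P.map (R i)) :=
    Measure.isProbabilityMeasure_map hN.measurable.aemeasurable
  have hQu : palmMeasure (P.map (R i)) univ = intensity P (R i) := by
    rw [palmMeasure_univ, intensity_eq_lintegral_map hN.measurable]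
  have hQ : IsFiniteMeasure (palmMeasure (P.map (R i))) := ⟨by rw [hQu]; exact hrate.2⟩
  have hfin : ∫⁻ S, S.counting (Ioc 0 1) ∂(P.map (R i)) ≠ ∞ := by
    rw [← intensity_eq_lintegral_map hN.measurable]; exact hrate.2.ne
  have h1 := hN.isStationary.palmMeasure_backward_eq_forward hfin (by
    simp only [real_palmMeasure_Ioc R hN.measurable hrate]; fun_prop) ht
  rw [real_palmMeasure_Ioc R hN.measurable hrate] at h1
  have := measureReal_compl (μ := palmMeasure (P.map (R i)))
    (measurableSet_counting_eq_zero (measurableSet_Ico (a := -t) (b := 0)))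
  rw [measureReal_def (s := univ), hQu, h1] at this
  rw [show {S : PointConfig | S.counting (Ico (-t) 0) ≠ 0}
    = {S | S.counting (Ico (-t) 0) = 0}ᶜ from rfl, this, rate]
  ring

lemma integral_visits_eq {i : ι} (hN : IsStationaryErgodic P (R i))
    (hrate : 0 < intensity P (R i) ∧ intensity P (R i) < ∞) {t : ℝ} (ht : 0 ≤ t) (s : ℝ) :
    ∫ ω, (R i ω).visits t s ∂P
      = rate P R i * ∫ u in (0 : ℝ)..t, (1 - interRequestCdf P R i u) := by
  have hp' : IsProbabilityMeasure (P.map (R i)) :=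
    Measure.isProbabilityMeasure_map hN.measurable.aemeasurable
  have hfin : ∫⁻ S, S.counting (Ioc 0 1) ∂(P.map (R i)) ≠ ∞ := by
    rw [← intensity_eq_lintegral_map hN.measurable]; exact hrate.2.ne
  have h1 := (hN.isStationary.real_measure_counting_Ico_eq hfin ht).1
  simp only [real_palmMeasure_Ioc R hN.measurable hrate] at h1
  rw [intervalIntegral.integral_const_mul] at h1
  rw [← h1, measureReal_def, ← hN.isStationary.measure_counting_shift s measurableSet_Ico,
    ← measureReal_def]
  have h2 := integral_visits (μ := P.map (R i)) t s
  rw [integral_map (f := fun S : PointConfig => S.visits t s) hN.measurable.aemeasurable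
    (measurable_visits (g := fun S => S) measurable_id t measurable_const).aestronglyMeasurable]
    at h2
  rw [h2]
  congr 2
  ext S
  rw [show (fun x => x - s) ⁻¹' Ico (-t) 0 = Ico (s - t) s by
    ext x; simp only [mem_preimage, mem_Ico]; constructor <;> rintro ⟨h, h'⟩ <;>
      constructor <;> linarith]

end Family

open PointConfig

lemma PointConfig.measurable_counting_comp {α : Type*} [MeasurableSpace α] {g : α → PointConfig}
    (hg : Measurable g) {B : Set ℝ} (hB : MeasurableSet B) :
    Measurable fun a => (g a).counting B :=
  (measurable_counting_apply hB).comp hg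

/-! ### Concentration and bounds at a fixed time for the hit probability -/

section Bounds

variable {Ω : Type*} [MeasurableSpace Ω] {P : Measure Ω} [IsProbabilityMeasure P]
  {ι : Type*} [Fintype ι] {R : ι → Ω → PointConfig}

/-- A stationary process almost surely has no point at a prescribed time. By independence this
extends to the times given by another process: Fubini's bound with `ε = 0`. -/
lemma ae_disjoint_points (hR : ∀ i, IsStationaryErgodic P (R i)) (hind : iIndepFun R P)
    (hrate : ∀ i, 0 < intensity P (R i) ∧ intensity P (R i) < ∞) :
    ∀ᵐ ω ∂P, Pairwise (Function.onFun Disjoint fun i => (R i ω).points) := by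
  have key : ∀ i l, i ≠ l → ∀ᵐ ω ∂P, Disjoint (R i ω).points (R l ω).points := by
    intro i l hil
    have hp' : IsProbabilityMeasure (P.map (R l)) :=
      Measure.isProbabilityMeasure_map (hR l).measurable.aemeasurable
    have hD : MeasurableSet {q : PointConfig × ℝ | q.1.counting {q.2} ≠ 0} :=
      (measurable_counting_section (g := fun q : PointConfig × ℝ => q.1) measurable_fst
        (D := {r | r.2 = r.1.2}) (measurableSet_eq_fun measurable_snd measurable_fst.snd)
        (measurableSet_singleton 0)).compl
    have h0 := lintegral_counting_le_of_indepFun (hR i).measurable (hR l).measurable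
      (hind.indepFun hil) hD MeasurableSet.univ (ε := 0) (fun s _ => by
        have h1 : ∫⁻ ω, (R l ω).counting {s} ∂P = 0 := by
          rw [← lintegral_map (measurable_counting_apply (measurableSet_singleton s))
            (hR l).measurable]
          refine (hR l).isStationary.lintegral_counting_singleton ?_ s
          rw [← intensity_eq_lintegral_map (hR l).measurable]; exact (hrate l).2.ne
        rw [lintegral_eq_zero_iff
          (measurable_counting_comp (hR l).measurable (measurableSet_singleton s))] at h1
        exact (measure_mono_null (fun ω hω => hω) (ae_iff.1 h1)).le)
    rw [zero_mul, nonpos_iff_eq_zero, lintegral_eq_zero_iff] at h0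
    · filter_upwards [h0] with ω hω
      rw [Pi.zero_apply, counting_eq_zero_iff] at hω
      rw [Set.disjoint_left]
      intro x hx hxl
      refine hω x hx ⟨mem_univ _, ?_⟩
      exact (counting_ne_zero_iff _ _).2 ⟨x, hxl, rfl⟩
    · refine measurable_counting_section (hR i).measurable
        (D := {q : Ω × ℝ | q.2 ∈ univ ∧ (R l q.1, q.2) ∈ _}) ?_
      exact (measurable_snd MeasurableSet.univ).inter
        ((((hR l).measurable.comp measurable_fst).prodMk measurable_snd) hD)
  have : ∀ᵐ ω ∂P, ∀ i l, i ≠ l → Disjoint (R i ω).points (R l ω).points :=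
    ae_all_iff.2 fun i => ae_all_iff.2 fun l => ae_all_iff.2 fun h => key i l h
  filter_upwards [this] with ω hω i l hil using hω i l hil

omit [MeasurableSpace Ω] in
lemma counting_superpose {ω : Ω}
    (h : Pairwise (Function.onFun Disjoint fun i => (R i ω).points)) (B : Set ℝ) :
    (superpose fun i => R i ω).counting B = ∑ i, (R i ω).counting B := by
  unfold counting superpose
  rw [Measure.restrict_iUnion h fun i => (R i ω).countable_points.measurableSet,
    Measure.sum_fintype, Measure.finsetSum_apply]

omit [MeasurableSpace Ω] in
-- Since the processes have no common points, a point of `R i` at `s` determines the requested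
-- content, and the existential quantifier in `lruHit` can only refer to `i`.
lemma counting_superpose_lruHit {ω : Ω}
    (h : Pairwise (Function.onFun Disjoint fun i => (R i ω).points)) (C : ℕ) :
    (superpose fun i => R i ω).counting
        {s | s ∈ Ioc (0 : ℝ) 1 ∧ (fun i => (R i ω).shift s) ∈ lruHit C}
      = ∑ i, (R i ω).counting {s | s ∈ Ioc (0 : ℝ) 1 ∧
          requested (fun i => (R i ω).shift s) i
            (evictionTime C fun i => (R i ω).shift s) = 1} := by
  rw [counting_superpose h]
  refine Finset.sum_congr rfl fun i _ => ?_
  rw [counting_apply, counting_apply]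
  congr 2
  ext s
  simp only [mem_inter_iff, mem_ofPred_eq, lruHit, and_congr_left_iff, and_congr_right_iff]
  intro hs _
  constructor
  · rintro ⟨l, hl, hreq⟩
    have hl' : s ∈ (R l ω).points := by simpa [shift] using hl
    by_cases hil : i = l
    · exact hil ▸ hreq
    · exact absurd hl' (Set.disjoint_left.1 (h hil) hs)
  · exact fun hreq => ⟨i, by simpa [shift] using hs, hreq⟩

/-- At time `s`, the number of contents other than `i` requested during `[s - t, s)` is at least
`D` away from its mean. -/
def deviates [DecidableEq ι] (P : Measure Ω) (R : ι → Ω → PointConfig) (t D : ℝ) (i : ι) (ω : Ω)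
    (s : ℝ) : Prop :=
  D ≤ |∑ l ∈ Finset.univ.erase i, (R l ω).visits t s
    - ∑ l ∈ Finset.univ.erase i, ∫ ω, (R l ω).visits t s ∂P|

omit [Fintype ι] in
lemma memLp_visits (hR : ∀ i, IsStationaryErgodic P (R i)) (t s : ℝ) (i : ι) :
    MemLp (fun ω => (R i ω).visits t s) 2 P := by
  refine MemLp.of_bound
    (measurable_visits (hR i).measurable t measurable_const).aestronglyMeasurable 1
    (ae_of_all _ fun ω => ?_)
  rw [Real.norm_of_nonneg (visits_nonneg _ _ _)]
  exact visits_le_one _ _ _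

variable [DecidableEq ι]

/-- Chebyshev's inequality: the indicators are independent and each has variance at most one. -/
lemma measure_deviates_le (hR : ∀ i, IsStationaryErgodic P (R i)) (hind : iIndepFun R P)
    (t : ℝ) {D : ℝ} (hD : 0 < D) (i : ι) (s : ℝ) :
    P {ω | deviates P R t D i ω s} ≤ ENNReal.ofReal (Fintype.card ι / D ^ 2) := by
  have hL := fun l => memLp_visits hR t s l
  set X : ι → Ω → ℝ := fun l ω => (R l ω).visits t s with hX
  have hLs : MemLp (∑ l ∈ Finset.univ.erase i, X l) 2 P := memLp_finsetSum' _ fun l _ => hL l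
  have h := meas_ge_le_variance_div_sq hLs hD
  have hint : ∫ ω, (∑ l ∈ Finset.univ.erase i, X l) ω ∂P
      = ∑ l ∈ Finset.univ.erase i, ∫ ω, X l ω ∂P := by
    simp only [Finset.sum_apply]
    exact integral_finsetSum _ fun l _ => (hL l).integrable one_le_two
  rw [hint] at h
  simp only [Finset.sum_apply] at h
  refine h.trans (ENNReal.ofReal_le_ofReal ?_)
  gcongr
  have hindX : iIndepFun X P := hind.comp (fun _ S => S.visits t s)
    fun _ => measurable_visits (g := fun S => S) measurable_id t measurable_const
  rw [IndepFun.variance_sum (fun l _ => hL l) fun a _ b _ hab => hindX.indepFun hab]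
  calc ∑ l ∈ Finset.univ.erase i, Var[X l; P] ≤ ∑ l ∈ Finset.univ.erase i, (1 : ℝ) := by
        refine Finset.sum_le_sum fun l _ => ?_
        refine (variance_le_expectation_sq (hL l).aestronglyMeasurable).trans ?_
        have : ∫ ω, (X l ^ 2) ω ∂P ≤ ∫ ω, (1 : ℝ) ∂P := by
          refine integral_mono (hL l).integrable_sq (integrable_const _) fun ω => ?_
          exact pow_le_one₀ (n := 2) (visits_nonneg (R l ω) t s) (visits_le_one (R l ω) t s)
        simpa using this
    _ ≤ Fintype.card ι := by
        rw [Finset.sum_const, nsmul_one, Nat.cast_le]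
        exact Finset.card_le_univ _

omit [IsProbabilityMeasure P] [Fintype ι] [DecidableEq ι] in
lemma integral_visits_eq_at_zero (hR : ∀ i, IsStationaryErgodic P (R i)) (t : ℝ) (l : ι)
    (s : ℝ) : ∫ ω, (R l ω).visits t s ∂P = ∫ ω, (R l ω).visits t 0 ∂P := by
  have hmap : ∀ s, ∫ ω, (R l ω).visits t s ∂P
      = (P.map (R l)).real {S | S.counting (Ico (s - t) s) ≠ 0} := fun s => by
    rw [← integral_visits, integral_map (f := fun S : PointConfig => S.visits t s)
      (hR l).measurable.aemeasurable
      (measurable_visits (g := fun S => S) measurable_id t measurable_const).aestronglyMeasurable]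
  rw [hmap, hmap, measureReal_def, measureReal_def,
    ← (hR l).isStationary.measure_counting_shift s (measurableSet_Ico (a := 0 - t) (b := 0))]
  congr 3
  ext S
  rw [show (fun x => x - s) ⁻¹' Ico (0 - t) 0 = Ico (s - t) s by
    ext x; simp only [mem_preimage, mem_Ico]; constructor <;> rintro ⟨h, h'⟩ <;>
      constructor <;> linarith]

omit [IsProbabilityMeasure P] in
-- The event depends only on `s` and the processes other than `R i`, which is what independence
-- needs. Stationarity replaces the mean at `s` by that at `0`, so the centring constant is free of
-- `s` and joint measurability is clear.
lemma measurableSet_deviates (hR : ∀ i, IsStationaryErgodic P (R i)) (t D : ℝ) (i : ι) :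
    ∃ E : Set (((l : (Finset.univ.erase i : Finset ι)) → PointConfig) × ℝ), MeasurableSet E ∧
      ∀ ω s, ((fun l : (Finset.univ.erase i : Finset ι) => R l ω), s) ∈ E ↔ deviates P R t D i ω s := by
  refine ⟨{q : ((l : (Finset.univ.erase i : Finset ι)) → PointConfig) × ℝ | D ≤ |∑ l, (q.1 l).visits t q.2
    - ∑ l ∈ Finset.univ.erase i, ∫ ω, (R l ω).visits t 0 ∂P|}, ?_, fun ω s => ?_⟩
  · refine measurableSet_le measurable_const (Measurable.abs (Measurable.sub_const ?_ _))
    exact Finset.measurable_sum _ fun l _ => measurable_visits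
      (g := fun q : ((l : (Finset.univ.erase i : Finset ι)) → PointConfig) × ℝ => q.1 l)
      ((measurable_pi_apply l).comp measurable_fst) t measurable_snd
  · simp only [mem_ofPred_eq, deviates, integral_visits_eq_at_zero hR t _ s]
    rw [Finset.sum_coe_sort (Finset.univ.erase i) fun l => (R l ω).visits t s]

/-- Leaving content `i` out of the count makes the deviation independent of `R i`, so the Chebyshev
bound at fixed times carries over to the points of `R i`. -/
lemma lintegral_counting_deviates_le (hR : ∀ i, IsStationaryErgodic P (R i))
    (hind : iIndepFun R P) (t : ℝ) {D : ℝ} (hD : 0 < D) (i : ι) :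
    ∫⁻ ω, (R i ω).counting {s | s ∈ Ioc (0 : ℝ) 1 ∧ deviates P R t D i ω s} ∂P
      ≤ ENNReal.ofReal (Fintype.card ι / D ^ 2) * intensity P (R i) := by
  obtain ⟨E, hE, hEd⟩ := measurableSet_deviates hR t D i
  have hindep := (hind.indepFun_finset {i} (Finset.univ.erase i) (by simp)
    fun l => (hR l).measurable).comp
    (φ := fun x : ((l : ({i} : Finset ι)) → PointConfig) => x ⟨i, Finset.mem_singleton_self i⟩)
    (ψ := id) (measurable_pi_apply (X := fun _ : ({i} : Finset ι) => PointConfig) _) measurable_id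
  have h := lintegral_counting_le_of_indepFun (P := P) (hR i).measurable
    (measurable_pi_lambda _ fun l : (Finset.univ.erase i : Finset ι) => (hR l).measurable)
    hindep hE measurableSet_Ioc (I := Ioc 0 1) (ε := ENNReal.ofReal (Fintype.card ι / D ^ 2))
    (fun s _ => by
      simp only [hEd]
      exact measure_deviates_le hR hind t hD i s)
  simp only [hEd] at h
  exact h

omit [IsProbabilityMeasure P] in
lemma measurable_counting_deviates (hR : ∀ i, IsStationaryErgodic P (R i)) (t D : ℝ) (i : ι) :
    Measurable fun ω => (R i ω).counting {s | s ∈ Ioc (0 : ℝ) 1 ∧ deviates P R t D i ω s} := by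
  obtain ⟨E, hE, hEd⟩ := measurableSet_deviates hR t D i
  simp only [← hEd]
  refine measurable_counting_section (hR i).measurable
    (D := {q : Ω × ℝ | q.2 ∈ Ioc (0 : ℝ) 1 ∧
      ((fun l : (Finset.univ.erase i : Finset ι) => R l q.1), q.2) ∈ E}) ?_
  have hg : Measurable fun q : Ω × ℝ =>
      ((fun l : (Finset.univ.erase i : Finset ι) => R l q.1), q.2) :=
    (measurable_pi_lambda _ fun l : (Finset.univ.erase i : Finset ι) =>
      (hR l).measurable.comp measurable_fst).prodMk measurable_snd
  exact (measurable_snd measurableSet_Ioc).inter (hg hE)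

omit [MeasurableSpace Ω] in
lemma numRequested_shift_eq (ω : Ω) {t : ℝ} (ht : 0 ≤ t) (s : ℝ) (i : ι) :
    (numRequested (fun i => (R i ω).shift s) (ENNReal.ofReal t) : ℝ)
      = (R i ω).visits t s + ∑ l ∈ Finset.univ.erase i, (R l ω).visits t s := by
  rw [numRequested, Nat.cast_sum,
    Finset.add_sum_erase _ (fun l => (R l ω).visits t s) (Finset.mem_univ i)]
  exact Finset.sum_congr rfl fun l _ => requested_shift_eq_visits (fun i => R i ω) l ht s

/-- The omitted content contributes at most one; hence the `1` in the conditions comparing the mean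
with `C`. -/
lemma sum_integral_visits_split (hR : ∀ i, IsStationaryErgodic P (R i)) (t s : ℝ) (i : ι) :
    ∑ l ∈ Finset.univ.erase i, ∫ ω, (R l ω).visits t s ∂P ≤ ∑ l, ∫ ω, (R l ω).visits t 0 ∂P ∧
    ∑ l, ∫ ω, (R l ω).visits t 0 ∂P
      ≤ 1 + ∑ l ∈ Finset.univ.erase i, ∫ ω, (R l ω).visits t s ∂P := by
  have h1 : ∫ ω, (R i ω).visits t 0 ∂P ≤ 1 := by
    have : ∫ ω, (R i ω).visits t 0 ∂P ≤ ∫ ω, (1 : ℝ) ∂P :=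
      integral_mono ((memLp_visits hR t 0 i).integrable one_le_two) (integrable_const _)
        fun ω => visits_le_one _ _ _
    simpa using this
  have h0 : 0 ≤ ∫ ω, (R i ω).visits t 0 ∂P := integral_nonneg fun ω => visits_nonneg _ _ _
  simp only [integral_visits_eq_at_zero hR t _ s]
  rw [← Finset.add_sum_erase _ _ (Finset.mem_univ i)]
  constructor <;> linarith

/-- Without a deviation at least `C` contents are requested in the window, so the eviction time is
at most `t`. -/
lemma requested_of_hit_of_not_deviates (hR : ∀ i, IsStationaryErgodic P (R i)) {C : ℕ} {t D : ℝ}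
    (ht : 0 ≤ t) (hq : C + D + 1 ≤ ∑ l, ∫ ω, (R l ω).visits t 0 ∂P) {i : ι} {ω : Ω} {s : ℝ}
    (hd : ¬ deviates P R t D i ω s)
    (h : requested (fun i => (R i ω).shift s) i (evictionTime C fun i => (R i ω).shift s) = 1) :
    (R i ω).counting (Ico (s - t) s) ≠ 0 := by
  rw [← requested_shift_eq_one_iff (fun i => R i ω) i ht s]
  refine requested_eq_one_of_evictionTime ?_ h
  rw [deviates, not_le, abs_lt] at hd
  have hsp := (sum_integral_visits_split hR t s i).2
  have hn := numRequested_shift_eq (R := R) ω ht s i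
  have := visits_nonneg (R i ω) t s
  have h3 : (C : ℝ) ≤ (numRequested (fun i => (R i ω).shift s) (ENNReal.ofReal t) : ℝ) := by
    linarith [hd.1]
  exact_mod_cast h3

/-- Without a deviation the other contents number less than `C - 1`, so even with content `i` the
window holds fewer than `C`. -/
lemma hit_of_requested_of_not_deviates (hR : ∀ i, IsStationaryErgodic P (R i)) {C : ℕ} {t D : ℝ}
    (ht : 0 ≤ t) (hq : ∑ l, ∫ ω, (R l ω).visits t 0 ∂P ≤ C - D - 1) {i : ι} {ω : Ω} {s : ℝ}
    (hd : ¬ deviates P R t D i ω s) (h : (R i ω).counting (Ico (s - t) s) ≠ 0) :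
    requested (fun i => (R i ω).shift s) i (evictionTime C fun i => (R i ω).shift s) = 1 := by
  rw [← requested_shift_eq_one_iff (fun i => R i ω) i ht s] at h
  refine requested_evictionTime_eq_one ?_ h
  rw [deviates, not_le, abs_lt] at hd
  have hsp := (sum_integral_visits_split hR t s i).1
  have hn := numRequested_shift_eq (R := R) ω ht s i
  have := visits_le_one (R i ω) t s
  have h3 : (numRequested (fun i => (R i ω).shift s) (ENNReal.ofReal t) : ℝ) < C := by
    linarith [hd.2]
  exact_mod_cast h3

omit [DecidableEq ι] in
lemma intensity_superpose (hR : ∀ i, IsStationaryErgodic P (R i)) (hind : iIndepFun R P)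
    (hrate : ∀ i, 0 < intensity P (R i) ∧ intensity P (R i) < ∞) :
    intensity P (fun ω => superpose fun i => R i ω) = ∑ i, intensity P (R i) := by
  unfold intensity
  rw [← lintegral_finsetSum _ fun i _ =>
    measurable_counting_comp (hR i).measurable measurableSet_Ioc]
  refine lintegral_congr_ae ?_
  filter_upwards [ae_disjoint_points hR hind hrate] with ω hω
  exact counting_superpose hω _

omit [DecidableEq ι] in
lemma toReal_intensity_superpose (hR : ∀ i, IsStationaryErgodic P (R i)) (hind : iIndepFun R P)
    (hrate : ∀ i, 0 < intensity P (R i) ∧ intensity P (R i) < ∞) :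
    (intensity P (fun ω => superpose fun i => R i ω)).toReal = ∑ i, rate P R i := by
  rw [intensity_superpose hR hind hrate, ENNReal.toReal_sum fun i _ => (hrate i).2.ne]
  rfl

omit [Fintype ι] [DecidableEq ι] in
lemma palmMeasure_Ico_eq_ofReal (hR : ∀ i, IsStationaryErgodic P (R i))
    (hrate : ∀ i, 0 < intensity P (R i) ∧ intensity P (R i) < ∞)
    (hc : ∀ i, Continuous (interRequestCdf P R i)) {t : ℝ} (ht : 0 < t) (i : ι) :
    ∫⁻ ω, (R i ω).counting {s | s ∈ Ioc (0 : ℝ) 1 ∧ (R i ω).counting (Ico (s - t) s) ≠ 0} ∂P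
      = ENNReal.ofReal (rate P R i * interRequestCdf P R i t) := by
  have hp' : IsProbabilityMeasure (P.map (R i)) :=
    Measure.isProbabilityMeasure_map (hR i).measurable.aemeasurable
  have hQ : IsFiniteMeasure (palmMeasure (P.map (R i))) := ⟨by
    rw [palmMeasure_univ, ← intensity_eq_lintegral_map (hR i).measurable]; exact (hrate i).2⟩
  rw [← real_palmMeasure_Ico R (hR i) (hrate i) (hc i) ht, ofReal_measureReal,
    ← lintegral_counting_shift_eq_palmMeasure (hR i).measurable
      (measurableSet_counting_ne_zero measurableSet_Ico)]
  refine lintegral_congr fun ω => ?_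
  congr 1
  ext s
  simp only [mem_ofPred_eq, counting_shift]
  rw [show (fun x => x - s) ⁻¹' Ico (-t) 0 = Ico (s - t) s by
    ext x; simp only [mem_preimage, mem_Ico]; constructor <;> rintro ⟨h, h'⟩ <;>
      constructor <;> linarith]

omit [IsProbabilityMeasure P] [Fintype ι] [DecidableEq ι] in
lemma interRequestCdf_nonneg (i : ι) (t : ℝ) : 0 ≤ interRequestCdf P R i t :=
  ENNReal.toReal_nonneg

omit [IsProbabilityMeasure P] [DecidableEq ι] in
lemma sum_rate_mul_add_eq (t ε : ℝ) (hΛ : 0 < ∑ i, rate P R i) :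
    (∑ i, (rate P R i * interRequestCdf P R i t + ε * rate P R i)) / ∑ i, rate P R i
      = ∑ i, popularity P R i * interRequestCdf P R i t + ε := by
  rw [Finset.sum_add_distrib, ← Finset.mul_sum, add_div, mul_div_cancel_right₀ _ hΛ.ne',
    Finset.sum_div]
  congr 1
  exact Finset.sum_congr rfl fun i _ => by rw [popularity]; ring

/-- The hit probability is bounded above by the characteristic time approximation at any time `t`
at which the mean number of requested contents exceeds the cache size. -/
theorem lruHitProb_le [Nonempty ι] (hR : ∀ i, IsStationaryErgodic P (R i)) (hind : iIndepFun R P)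
    (hrate : ∀ i, 0 < intensity P (R i) ∧ intensity P (R i) < ∞)
    (hc : ∀ i, Continuous (interRequestCdf P R i)) {C : ℕ} {t D : ℝ} (ht : 0 < t) (hD : 0 < D)
    (hq : C + D + 1 ≤ ∑ i, rate P R i * ∫ u in (0 : ℝ)..t, (1 - interRequestCdf P R i u)) :
    lruHitProb P R C
      ≤ ∑ i, popularity P R i * interRequestCdf P R i t + Fintype.card ι / D ^ 2 := by
  set ε : ℝ := Fintype.card ι / D ^ 2 with hε
  have hε0 : 0 ≤ ε := by positivity
  have hpos : ∀ i, 0 < rate P R i := fun i => ENNReal.toReal_pos (hrate i).1.ne' (hrate i).2.ne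
  have hΛ : 0 < ∑ i, rate P R i := Finset.sum_pos (fun i _ => hpos i) Finset.univ_nonempty
  simp only [← integral_visits_eq R (hR _) (hrate _) ht.le 0] at hq
  rw [lruHitProb, palmProb, ENNReal.toReal_div, toReal_intensity_superpose hR hind hrate,
    ← sum_rate_mul_add_eq t ε hΛ]
  refine div_le_div_of_nonneg_right ?_ hΛ.le
  refine ENNReal.toReal_le_of_le_ofReal (Finset.sum_nonneg fun i _ => add_nonneg
    (mul_nonneg (hpos i).le (interRequestCdf_nonneg i t)) (mul_nonneg hε0 (hpos i).le)) ?_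
  have hm1 : ∀ i, Measurable fun ω => (R i ω).counting
      {s | s ∈ Ioc (0 : ℝ) 1 ∧ (R i ω).counting (Ico (s - t) s) ≠ 0} := fun i =>
    measurable_counting_section (hR i).measurable
      (D := {q | q.2 ∈ Ioc (0 : ℝ) 1 ∧ (R i q.1).counting (Ico (q.2 - t) q.2) ≠ 0})
      ((measurable_snd measurableSet_Ioc).inter (measurableSet_counting_Ico
        ((hR i).measurable.comp measurable_fst) (measurable_snd.sub_const t) measurable_snd))
  calc ∫⁻ ω, (superpose fun i => R i ω).counting
        {s | s ∈ Ioc (0 : ℝ) 1 ∧ (fun i => (R i ω).shift s) ∈ lruHit C} ∂P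
      ≤ ∫⁻ ω, ∑ i, ((R i ω).counting
          {s | s ∈ Ioc (0 : ℝ) 1 ∧ (R i ω).counting (Ico (s - t) s) ≠ 0}
        + (R i ω).counting {s | s ∈ Ioc (0 : ℝ) 1 ∧ deviates P R t D i ω s}) ∂P := by
        refine lintegral_mono_ae ?_
        filter_upwards [ae_disjoint_points hR hind hrate] with ω hω
        rw [counting_superpose_lruHit hω]
        refine Finset.sum_le_sum fun i _ => (measure_mono ?_).trans (measure_union_le _ _)
        rintro s ⟨hs, hreq⟩
        by_cases hd : deviates P R t D i ω s
        · exact Or.inr ⟨hs, hd⟩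
        · exact Or.inl ⟨hs, requested_of_hit_of_not_deviates hR ht.le hq hd hreq⟩
    _ = ∑ i, (ENNReal.ofReal (rate P R i * interRequestCdf P R i t)
        + ∫⁻ ω, (R i ω).counting {s | s ∈ Ioc (0 : ℝ) 1 ∧ deviates P R t D i ω s} ∂P) := by
        rw [lintegral_finsetSum _ fun i _ =>
          Measurable.fun_add (hm1 i) (measurable_counting_deviates hR t D i)]
        refine Finset.sum_congr rfl fun i _ => ?_
        rw [lintegral_add_left (hm1 i), palmMeasure_Ico_eq_ofReal hR hrate hc ht i]
    _ ≤ ∑ i, ENNReal.ofReal (rate P R i * interRequestCdf P R i t + ε * rate P R i) := by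
        refine Finset.sum_le_sum fun i _ => ?_
        rw [ENNReal.ofReal_add (mul_nonneg (hpos i).le (interRequestCdf_nonneg i t))
          (mul_nonneg hε0 (hpos i).le), ENNReal.ofReal_mul hε0, rate,
          ENNReal.ofReal_toReal (hrate i).2.ne]
        exact add_le_add le_rfl (lintegral_counting_deviates_le hR hind t hD i)
    _ = _ := by
        rw [ENNReal.ofReal_sum_of_nonneg fun i _ => add_nonneg
          (mul_nonneg (hpos i).le (interRequestCdf_nonneg i t)) (mul_nonneg hε0 (hpos i).le)]

/-- The hit probability is bounded below by the characteristic time approximation at any time `t`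
at which the mean number of requested contents is less than the cache size. -/
theorem le_lruHitProb [Nonempty ι] (hR : ∀ i, IsStationaryErgodic P (R i)) (hind : iIndepFun R P)
    (hrate : ∀ i, 0 < intensity P (R i) ∧ intensity P (R i) < ∞)
    (hc : ∀ i, Continuous (interRequestCdf P R i)) {C : ℕ} {t D : ℝ} (ht : 0 < t) (hD : 0 < D)
    (hq : ∑ i, rate P R i * ∫ u in (0 : ℝ)..t, (1 - interRequestCdf P R i u) ≤ C - D - 1) :
    ∑ i, popularity P R i * interRequestCdf P R i t - Fintype.card ι / D ^ 2
      ≤ lruHitProb P R C := by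
  set ε : ℝ := Fintype.card ι / D ^ 2 with hε
  have hε0 : 0 ≤ ε := by positivity
  have hpos : ∀ i, 0 < rate P R i := fun i => ENNReal.toReal_pos (hrate i).1.ne' (hrate i).2.ne
  have hΛ : 0 < ∑ i, rate P R i := Finset.sum_pos (fun i _ => hpos i) Finset.univ_nonempty
  simp only [← integral_visits_eq R (hR _) (hrate _) ht.le 0] at hq
  rw [sub_eq_add_neg, lruHitProb, palmProb, ENNReal.toReal_div,
    toReal_intensity_superpose hR hind hrate, ← sum_rate_mul_add_eq t (-ε) hΛ]
  refine div_le_div_of_nonneg_right ?_ hΛ.le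
  set H := ∫⁻ ω, (superpose fun i => R i ω).counting
        {s | s ∈ Ioc (0 : ℝ) 1 ∧ (fun i => (R i ω).shift s) ∈ lruHit C} ∂P with hH
  -- The lower bound is first proved in `ℝ≥0∞` with the error term added to `H`, avoiding truncated
  -- subtraction; finiteness of `H` allows the passage to real numbers.
  have hHfin : H ≠ ∞ := by
    refine ((lintegral_mono fun ω => measure_mono fun s hs => hs.1).trans_lt
      (b := intensity P (fun ω => superpose fun i => R i ω)) ?_).ne
    rw [intensity_superpose hR hind hrate]
    exact ENNReal.sum_lt_top.2 fun i _ => (hrate i).2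
  have key : ∑ i, ENNReal.ofReal (rate P R i * interRequestCdf P R i t)
      ≤ H + ∑ i, ENNReal.ofReal (ε * rate P R i) := by
    calc ∑ i, ENNReal.ofReal (rate P R i * interRequestCdf P R i t)
        ≤ ∫⁻ ω, ∑ i, (R i ω).counting
          {s | s ∈ Ioc (0 : ℝ) 1 ∧ (R i ω).counting (Ico (s - t) s) ≠ 0} ∂P := by
          simp only [← palmMeasure_Ico_eq_ofReal hR hrate hc ht]
          rw [lintegral_finsetSum]
          exact fun i _ => measurable_counting_section (hR i).measurable
            (D := {q | q.2 ∈ Ioc (0 : ℝ) 1 ∧ (R i q.1).counting (Ico (q.2 - t) q.2) ≠ 0})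
            ((measurable_snd measurableSet_Ioc).inter (measurableSet_counting_Ico
            ((hR i).measurable.comp measurable_fst) (measurable_snd.sub_const t) measurable_snd))
      _ ≤ ∫⁻ ω, ((superpose fun i => R i ω).counting
            {s | s ∈ Ioc (0 : ℝ) 1 ∧ (fun i => (R i ω).shift s) ∈ lruHit C}
          + ∑ i, (R i ω).counting {s | s ∈ Ioc (0 : ℝ) 1 ∧ deviates P R t D i ω s}) ∂P := by
          refine lintegral_mono_ae ?_
          filter_upwards [ae_disjoint_points hR hind hrate] with ω hω
          rw [counting_superpose_lruHit hω, ← Finset.sum_add_distrib]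
          refine Finset.sum_le_sum fun i _ => (measure_mono ?_).trans (measure_union_le _ _)
          rintro s ⟨hs, hreq⟩
          by_cases hd : deviates P R t D i ω s
          · exact Or.inr ⟨hs, hd⟩
          · exact Or.inl ⟨hs, hit_of_requested_of_not_deviates hR ht.le hq hd hreq⟩
      _ ≤ H + ∑ i, ENNReal.ofReal (ε * rate P R i) := by
          rw [lintegral_add_right _ (Finset.measurable_sum _ fun i _ =>
            measurable_counting_deviates hR t D i), lintegral_finsetSum _ fun i _ =>
            measurable_counting_deviates hR t D i]
          refine add_le_add le_rfl (Finset.sum_le_sum fun i _ => ?_)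
          rw [ENNReal.ofReal_mul hε0, rate, ENNReal.ofReal_toReal (hrate i).2.ne]
          exact lintegral_counting_deviates_le hR hind t hD i
  rw [← ENNReal.ofReal_sum_of_nonneg fun i _ => mul_nonneg (hpos i).le
    (interRequestCdf_nonneg i t), ← ENNReal.ofReal_sum_of_nonneg fun i _ =>
    mul_nonneg hε0 (hpos i).le, ← ENNReal.ofReal_toReal hHfin,
    ← ENNReal.ofReal_add ENNReal.toReal_nonneg
      (Finset.sum_nonneg fun i _ => mul_nonneg hε0 (hpos i).le),
    ENNReal.ofReal_le_ofReal_iff (add_nonneg ENNReal.toReal_nonneg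
      (Finset.sum_nonneg fun i _ => mul_nonneg hε0 (hpos i).le))] at key
  simp only [neg_mul, Finset.sum_add_distrib, Finset.sum_neg_distrib]
  linarith

end Bounds

/-! ### Sums as integrals of step functions -/

section StepFunction

/-- The function on `(0, 1]` that takes the value `a k` on `(k / m, (k + 1) / m]`. -/
noncomputable def stepFun {m : ℕ} (a : Fin m → ℝ) (x : ℝ) : ℝ :=
  if h : ⌈(m : ℝ) * x⌉₊ - 1 < m then a ⟨⌈(m : ℝ) * x⌉₊ - 1, h⟩ else 0

variable {m : ℕ} (a : Fin m → ℝ)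

/-- The ceiling matches cells closed on the right: on the cell of `k` it equals `k + 1`, which
explains the subtraction of one in `stepFun`. -/
lemma stepFun_of_mem {k : Fin m} {x : ℝ} (hx : x ∈ Ioc ((k : ℝ) / m) (((k : ℝ) + 1) / m)) :
    stepFun a x = a k := by
  have hm : (0 : ℝ) < m := Nat.cast_pos.2 k.pos
  have h1 : (k : ℝ) < m * x := by rw [mul_comm]; exact (div_lt_iff₀ hm).1 hx.1
  have h2 : m * x ≤ (k : ℝ) + 1 := by rw [mul_comm]; exact (le_div_iff₀ hm).1 hx.2
  have hc : ⌈(m : ℝ) * x⌉₊ = k + 1 := by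
    rw [Nat.ceil_eq_iff (Nat.succ_ne_zero _)]
    exact ⟨by simpa using h1, by exact_mod_cast h2⟩
  have hk : ⌈(m : ℝ) * x⌉₊ - 1 = k := by omega
  unfold stepFun
  rw [dif_pos (by rw [hk]; exact k.2)]
  congr 1
  exact Fin.ext hk

lemma exists_mem_Ioc_div (hm : 0 < m) {x : ℝ} (hx : x ∈ Ioc (0 : ℝ) 1) :
    ∃ k : Fin m, x ∈ Ioc ((k : ℝ) / m) (((k : ℝ) + 1) / m) := by
  have hm' : (0 : ℝ) < m := Nat.cast_pos.2 hm
  have hpos : 0 < ⌈(m : ℝ) * x⌉₊ := Nat.ceil_pos.2 (mul_pos hm' hx.1)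
  have hle : ⌈(m : ℝ) * x⌉₊ ≤ m := Nat.ceil_le.2 (by nlinarith [hx.2])
  obtain ⟨l, hl⟩ : ∃ l, ⌈(m : ℝ) * x⌉₊ = l + 1 := ⟨_, (Nat.succ_pred_eq_of_pos hpos).symm⟩
  have h := (Nat.ceil_eq_iff (Nat.succ_ne_zero l)).1 hl
  push_cast at h
  refine ⟨⟨l, by omega⟩, ?_, ?_⟩
  · rw [div_lt_iff₀ hm', mul_comm]; simpa using h.1
  · rw [le_div_iff₀ hm', mul_comm]; exact h.2

lemma stepFun_comp (hm : 0 < m) (φ : ℝ → ℝ) {x : ℝ} (hx : x ∈ Ioc (0 : ℝ) 1) :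
    φ (stepFun a x) = stepFun (fun k => φ (a k)) x := by
  obtain ⟨k, hk⟩ := exists_mem_Ioc_div hm hx
  rw [stepFun_of_mem a hk, stepFun_of_mem _ hk]

lemma measurable_stepFun : Measurable (stepFun a) := by
  have h : stepFun a = (fun l : ℕ => if h : l - 1 < m then a ⟨l - 1, h⟩ else 0)
      ∘ fun x : ℝ => ⌈(m : ℝ) * x⌉₊ := rfl
  rw [h]
  exact (measurable_from_top).comp (Nat.measurable_ceil.comp (measurable_const_mul _))

lemma stepFun_nonneg (ha : ∀ k, 0 ≤ a k) (x : ℝ) : 0 ≤ stepFun a x := by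
  unfold stepFun; split_ifs
  · exact ha _
  · exact le_rfl

lemma integrable_stepFun : Integrable (stepFun a) (volume.restrict (Ioc 0 1)) := by
  refine Integrable.of_bound (measurable_stepFun a).aestronglyMeasurable (∑ k, |a k|)
    (ae_of_all _ fun x => ?_)
  unfold stepFun
  split_ifs with h
  · exact Finset.single_le_sum (f := fun k => |a k|) (fun k _ => abs_nonneg _) (Finset.mem_univ _)
  · simpa using Finset.sum_nonneg fun k _ => abs_nonneg (a k)

lemma integral_stepFun (hm : 0 < m) :
    ∫ x in Ioc (0 : ℝ) 1, stepFun a x = (∑ k, a k) / m := by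
  have hm' : (0 : ℝ) < m := Nat.cast_pos.2 hm
  have hle : ∀ k : ℕ, (k : ℝ) / m ≤ ((k + 1 : ℕ) : ℝ) / m := fun k => by
    gcongr; linarith
  have hsub : ∀ k < m, Ioc ((k : ℝ) / m) (((k + 1 : ℕ) : ℝ) / m) ⊆ Ioc 0 1 := fun k hk =>
    Ioc_subset_Ioc (by positivity) (by rw [div_le_one hm']; exact_mod_cast hk)
  have h := intervalIntegral.sum_integral_adjacent_intervals (f := stepFun a) (μ := volume)
    (a := fun k : ℕ => (k : ℝ) / m) (n := m) (fun k hk => by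
      rw [intervalIntegrable_iff_integrableOn_Ioc_of_le (hle k)]
      exact IntegrableOn.mono_set (integrable_stepFun a) (hsub k hk))
  rw [Nat.cast_zero, zero_div, div_self hm'.ne',
    intervalIntegral.integral_of_le zero_le_one] at h
  rw [← h, Finset.sum_range, Finset.sum_div]
  refine Finset.sum_congr rfl fun k _ => ?_
  rw [intervalIntegral.integral_of_le (hle k), setIntegral_congr_fun measurableSet_Ioc
    (g := fun _ => a k) fun x hx => stepFun_of_mem a (by push_cast at hx; exact hx)]
  rw [setIntegral_const, measureReal_def, Real.volume_Ioc, ENNReal.toReal_ofReal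
    (sub_nonneg.2 (hle k)), smul_eq_mul]
  push_cast
  field_simp
  ring

end StepFunction

/-! ### The age distribution -/

section AgeCdf

variable {F : Measure ℝ}

lemma ageCdf_eq (hmean : ∫ x, x ∂F = 1) (t : ℝ) :
    ageCdf F t = ∫ z in (0 : ℝ)..t, (1 - cdf F z) := by
  rw [ageCdf, hmean, inv_one, one_mul]

lemma intervalIntegrable_one_sub_cdf (a b : ℝ) :
    IntervalIntegrable (fun z => 1 - cdf F z) volume a b :=
  (show Antitone fun z => 1 - cdf F z from
    fun _ _ h => sub_le_sub_left (monotone_cdf F h) 1).intervalIntegrable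

lemma continuous_ageCdf : Continuous (ageCdf F) :=
  continuous_const.mul (intervalIntegral.continuous_primitive
    (fun a b => intervalIntegrable_one_sub_cdf a b) 0)

lemma ageCdf_sub (hmean : ∫ x, x ∂F = 1) (s t : ℝ) :
    ageCdf F t - ageCdf F s = ∫ z in s..t, (1 - cdf F z) := by
  rw [ageCdf_eq hmean, ageCdf_eq hmean, intervalIntegral.integral_interval_sub_left]
  · exact intervalIntegrable_one_sub_cdf _ _
  · exact intervalIntegrable_one_sub_cdf _ _

@[simp]
lemma ageCdf_zero : ageCdf F 0 = 0 := by simp [ageCdf]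

lemma monotone_ageCdf (hmean : ∫ x, x ∂F = 1) : Monotone (ageCdf F) := fun s t h => by
  rw [← sub_nonneg, ageCdf_sub hmean]
  exact intervalIntegral.integral_nonneg h fun z _ => sub_nonneg.2 (cdf_le_one F z)

lemma ageCdf_nonneg (hmean : ∫ x, x ∂F = 1) {t : ℝ} (ht : 0 ≤ t) : 0 ≤ ageCdf F t := by
  simpa using monotone_ageCdf hmean ht

variable [IsProbabilityMeasure F]

lemma tendsto_ageCdf_atTop (hsupp : F (Iio 0) = 0) (hmean : ∫ x, x ∂F = 1) :
    Tendsto (ageCdf F) atTop (𝓝 1) := by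
  have hint : Integrable (fun x : ℝ => x) F := by
    -- The integral of a non-integrable function is `0` by convention, so mean one already forces
    -- integrability. The same argument gives integrability of the tail below.
    by_contra h
    rw [integral_undef h] at hmean
    exact zero_ne_one hmean
  have hnn : 0 ≤ᵐ[F] fun x : ℝ => x := by
    rw [EventuallyLE, ae_iff]
    simpa [Iio] using hsupp
  have h := hint.integral_eq_integral_meas_lt hnn
  have hcdf : ∀ t : ℝ, F.real {x | t < x} = 1 - cdf F t := fun t => by
    rw [cdf_eq_real, ← probReal_compl_eq_one_sub measurableSet_Iic]
    congr 1
    ext x; simp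
  simp only [hcdf] at h
  rw [hmean] at h
  have hI : IntegrableOn (fun t => 1 - cdf F t) (Ioi 0) := by
    by_contra h'
    rw [integral_undef h'] at h
    exact one_ne_zero h
  have := intervalIntegral_tendsto_integral_Ioi 0 hI tendsto_id
  rw [← h] at this
  exact this.congr fun t => (ageCdf_eq hmean t).symm

lemma ageCdf_le_one (hsupp : F (Iio 0) = 0) (hmean : ∫ x, x ∂F = 1) (t : ℝ) :
    ageCdf F t ≤ 1 :=
  (monotone_ageCdf hmean).ge_of_tendsto (tendsto_ageCdf_atTop hsupp hmean) t

/-- If the primitive of the antitone tail is flat on `[s, t]`, the tail vanishes at `t` and ever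
after. The age distribution is then constant from `t` on, equal to its limit `1`. -/
lemma ageCdf_eq_one_of_eq (hsupp : F (Iio 0) = 0) (hmean : ∫ x, x ∂F = 1) {s t : ℝ}
    (hst : s < t) (h : ageCdf F s = ageCdf F t) : ageCdf F s = 1 := by
  have h0 : ∫ z in s..t, (1 - cdf F z) = 0 := by rw [← ageCdf_sub hmean, h, sub_self]
  have h1 : ∫ _ in s..t, (1 - cdf F t) ≤ ∫ z in s..t, (1 - cdf F z) :=
    intervalIntegral.integral_mono_on hst.le intervalIntegrable_const
      (intervalIntegrable_one_sub_cdf _ _)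
      fun z hz => sub_le_sub_left (monotone_cdf F hz.2) 1
  rw [h0, intervalIntegral.integral_const, smul_eq_mul] at h1
  have h2 : cdf F t = 1 := by
    have := cdf_le_one F t
    nlinarith
  have h3 : ∀ u, t ≤ u → ageCdf F u = ageCdf F t := fun u hu => by
    rw [← sub_eq_zero, ageCdf_sub hmean]
    have : ∀ z ∈ uIcc t u, 1 - cdf F z = 0 := fun z hz => by
      rw [uIcc_of_le hu] at hz
      rw [sub_eq_zero]
      exact le_antisymm (h2 ▸ monotone_cdf F hz.1) (cdf_le_one F z)
    rw [intervalIntegral.integral_congr this]; simp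
  rw [h]
  refine tendsto_nhds_unique (tendsto_const_nhds.congr' ?_) (tendsto_ageCdf_atTop hsupp hmean)
  filter_upwards [eventually_ge_atTop t] with u hu using (h3 u hu).symm

end AgeCdf

/-! ### Scheffé's lemma -/

section Scheffe

variable {α : Type*} [MeasurableSpace α] {μ : Measure α}

/-- As `h n ≥ 0`, the positive part of `f - h n` is dominated by `f`, whatever the size of `h n`. -/
lemma tendsto_integral_posPart_sub {h : ℕ → α → ℝ} {f : α → ℝ} (hint : ∀ n, Integrable (h n) μ)
    (hnn : ∀ n, 0 ≤ᵐ[μ] h n) (hf : Integrable f μ) (hfnn : 0 ≤ᵐ[μ] f)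
    (hlim : ∀ᵐ x ∂μ, Tendsto (fun n => h n x) atTop (𝓝 (f x))) :
    Tendsto (fun n => ∫ x, max (f x - h n x) 0 ∂μ) atTop (𝓝 0) := by
  have := tendsto_integral_of_dominated_convergence (μ := μ)
    (F := fun n x => max (f x - h n x) 0) (f := fun _ => (0 : ℝ)) f
    (fun n => (hf.sub (hint n)).pos_part.aestronglyMeasurable) hf
    (fun n => by
      filter_upwards [hnn n, hfnn] with x hx hfx
      rw [Real.norm_of_nonneg (le_max_right _ _)]
      exact max_le (by simpa using hx) hfx)
    (by
      filter_upwards [hlim] with x hx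
      have := (tendsto_const_nhds (x := f x)).sub hx
      simpa using this.max (tendsto_const_nhds (x := (0 : ℝ))))
  simpa using this

/-- Scheffé's lemma for finitely many weighted sequences. -/
lemma tendsto_integral_abs_sub_of_tendsto_sum {ι : Type*} [Fintype ι] {h : ℕ → ι → α → ℝ}
    {f : ι → α → ℝ} {w : ℕ → ι → ℝ} {b : ι → ℝ} (hint : ∀ n j, Integrable (h n j) μ)
    (hnn : ∀ n j, 0 ≤ᵐ[μ] h n j) (hf : ∀ j, Integrable (f j) μ) (hfnn : ∀ j, 0 ≤ᵐ[μ] f j)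
    (hlim : ∀ j, ∀ᵐ x ∂μ, Tendsto (fun n => h n j x) atTop (𝓝 (f j x)))
    (hw : ∀ j, Tendsto (fun n => w n j) atTop (𝓝 (b j))) (hw0 : ∀ n j, 0 ≤ w n j)
    (hb : ∀ j, 0 < b j)
    (hsum : Tendsto (fun n => ∑ j, w n j * ∫ x, h n j x ∂μ) atTop (𝓝 (∑ j, b j * ∫ x, f j x ∂μ)))
    (j : ι) : Tendsto (fun n => ∫ x, |h n j x - f j x| ∂μ) atTop (𝓝 0) := by
  -- This is `|h - f| = h - f + 2 (f - h)⁺`, integrated.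
  have habs : ∀ n j, ∫ x, |h n j x - f j x| ∂μ
      = ∫ x, h n j x ∂μ - ∫ x, f j x ∂μ + 2 * ∫ x, max (f j x - h n j x) 0 ∂μ := fun n j => by
    have i1 : Integrable (fun x => h n j x - f j x) μ := (hint n j).sub (hf j)
    have i2 : Integrable (fun x => 2 * max (f j x - h n j x) 0) μ :=
      ((hf j).sub (hint n j)).pos_part.const_mul 2
    rw [← integral_const_mul, ← integral_sub (hint n j) (hf j), ← integral_add i1 i2]
    refine integral_congr_ae (ae_of_all _ fun x => ?_)
    rcases le_total (h n j x) (f j x) with hx | hx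
    · simp only [abs_of_nonpos (sub_nonpos.2 hx), max_eq_left (sub_nonneg.2 hx)]; ring
    · simp only [abs_of_nonneg (sub_nonneg.2 hx), max_eq_right (sub_nonpos.2 hx)]; ring
  have htot : Tendsto (fun n => ∑ j, w n j * ∫ x, |h n j x - f j x| ∂μ) atTop (𝓝 0) := by
    have h1 : Tendsto (fun n => ∑ j, w n j * ∫ x, f j x ∂μ) atTop
        (𝓝 (∑ j, b j * ∫ x, f j x ∂μ)) :=
      tendsto_finsetSum _ fun j _ => (hw j).mul_const _
    have h2 : Tendsto (fun n => ∑ j, w n j * (2 * ∫ x, max (f j x - h n j x) 0 ∂μ)) atTop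
        (𝓝 (∑ j, b j * (2 * 0))) :=
      tendsto_finsetSum _ fun j _ => (hw j).mul ((tendsto_integral_posPart_sub
        (fun n => hint n j) (fun n => hnn n j) (hf j) (hfnn j) (hlim j)).const_mul 2)
    have h3 := (hsum.sub h1).add h2
    simp only [mul_zero, Finset.sum_const_zero, sub_self, add_zero] at h3
    refine h3.congr fun n => ?_
    rw [← Finset.sum_sub_distrib, ← Finset.sum_add_distrib]
    refine Finset.sum_congr rfl fun j _ => ?_
    rw [habs]; ring
  -- Only the weighted sum of the masses is known to converge. The summands are nonnegative, so each
  -- of them tends to `0`; dividing by the weight, whose limit is positive, isolates the class.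
  have hterm : Tendsto (fun n => w n j * ∫ x, |h n j x - f j x| ∂μ) atTop (𝓝 0) := by
    have hterm0 : ∀ n j, 0 ≤ w n j * ∫ x, |h n j x - f j x| ∂μ := fun n j =>
      mul_nonneg (hw0 n j) (integral_nonneg fun x => abs_nonneg _)
    exact squeeze_zero (fun n => hterm0 n j) (fun n => Finset.single_le_sum
      (f := fun j => w n j * ∫ x, |h n j x - f j x| ∂μ) (fun j _ => hterm0 n j)
      (Finset.mem_univ j)) htot
  have := hterm.div (hw j) (hb j).ne'
  rw [zero_div] at this
  refine this.congr' ?_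
  filter_upwards [(hw j).eventually (lt_mem_nhds (hb j))] with n hn
  rw [Pi.div_apply, mul_div_cancel_left₀ _ hn.ne']

/-- Split `h φ(h) = f φ(h) + (h - f) φ(h)`. The first term is dominated by `|f|`, and the second is
bounded by the `L¹` distance. -/
lemma tendsto_integral_mul_comp {h : ℕ → α → ℝ} {f : α → ℝ} (hint : ∀ n, Integrable (h n) μ)
    (hf : Integrable f μ) (hlim : ∀ᵐ x ∂μ, Tendsto (fun n => h n x) atTop (𝓝 (f x)))
    (hL1 : Tendsto (fun n => ∫ x, |h n x - f x| ∂μ) atTop (𝓝 0)) {φ : ℝ → ℝ}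
    (hφ : Continuous φ) (hφ1 : ∀ x, |φ x| ≤ 1) :
    Tendsto (fun n => ∫ x, h n x * φ (h n x) ∂μ) atTop (𝓝 (∫ x, f x * φ (f x) ∂μ)) := by
  have hb : ∀ {g k : α → ℝ}, Integrable g μ → Integrable k μ →
      Integrable (fun x => g x * φ (k x)) μ := fun {g k} hg hk =>
    hg.mul_bdd (c := 1) (hφ.comp_aestronglyMeasurable hk.aestronglyMeasurable)
      (ae_of_all _ fun x => by simpa using hφ1 (k x))
  have h1 : Tendsto (fun n => ∫ x, f x * φ (h n x) ∂μ) atTop (𝓝 (∫ x, f x * φ (f x) ∂μ)) := by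
    refine tendsto_integral_of_dominated_convergence (fun x => |f x|)
      (fun n => (hb hf (hint n)).aestronglyMeasurable) hf.abs
      (fun n => ae_of_all _ fun x => ?_) ?_
    · rw [norm_mul, Real.norm_eq_abs, Real.norm_eq_abs]
      exact mul_le_of_le_one_right (abs_nonneg _) (hφ1 _)
    · filter_upwards [hlim] with x hx
      exact tendsto_const_nhds.mul ((hφ.tendsto _).comp hx)
  have h2 : Tendsto (fun n => ∫ x, (h n x - f x) * φ (h n x) ∂μ) atTop (𝓝 0) := by
    refine squeeze_zero_norm (fun n => ?_) hL1
    refine (norm_integral_le_integral_norm _).trans (integral_mono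
      (hb ((hint n).sub hf) (hint n)).norm ((hint n).sub hf).abs fun x => ?_)
    simp only [norm_mul, Real.norm_eq_abs]
    exact mul_le_of_le_one_right (abs_nonneg _) (hφ1 _)
  have h3 := h1.add h2
  rw [add_zero] at h3
  refine h3.congr fun n => ?_
  have i1 : Integrable (fun x => (h n x - f x) * φ (h n x)) μ := hb ((hint n).sub hf) (hint n)
  rw [← integral_add (hb hf (hint n)) i1]
  refine integral_congr_ae (ae_of_all _ fun x => ?_)
  simp only
  ring

end Scheffe

/-! ### The characteristic time equation -/

section Occupancy

variable {J : ℕ} {b : Fin J → ℝ} {Ψ : Fin J → Measure ℝ}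
  [∀ j, IsProbabilityMeasure (Ψ j)] {f : Fin J → ℝ → ℝ}

/-- The asymptotic fraction of the contents that are requested in an interval of scaled length
`ν`. -/
noncomputable def occupancy (b : Fin J → ℝ) (Ψ : Fin J → Measure ℝ) (f : Fin J → ℝ → ℝ) (ν : ℝ) :
    ℝ := ∑ j, b j * ∫ x in (0 : ℝ)..1, ageCdf (Ψ j) (ν * f j x)

/-- The asymptotic hit probability at the scaled characteristic time `ν`. -/
noncomputable def profileHit (b : Fin J → ℝ) (Ψ : Fin J → Measure ℝ) (f : Fin J → ℝ → ℝ) (ν : ℝ) :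
    ℝ := ∑ j, b j * ∫ x in (0 : ℝ)..1, f j x * cdf (Ψ j) (ν * f j x)

lemma abs_cdf_le_one (F : Measure ℝ) [IsProbabilityMeasure F] (x : ℝ) : |cdf F x| ≤ 1 := by
  rw [abs_of_nonneg (cdf_nonneg F x)]; exact cdf_le_one F x

lemma abs_ageCdf_le_one {F : Measure ℝ} [IsProbabilityMeasure F] (hsupp : F (Iio 0) = 0)
    (hmean : ∫ x, x ∂F = 1) {t : ℝ} (ht : 0 ≤ t) : |ageCdf F t| ≤ 1 := by
  rw [abs_of_nonneg (ageCdf_nonneg hmean ht)]; exact ageCdf_le_one hsupp hmean t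

lemma integrable_ageCdf_comp {F : Measure ℝ} [IsProbabilityMeasure F] (hsupp : F (Iio 0) = 0)
    (hmean : ∫ x, x ∂F = 1) {g : ℝ → ℝ} (hg : ContinuousOn g (Ioc 0 1))
    (hpos : ∀ᵐ x ∂(volume.restrict (Ioc (0 : ℝ) 1)), 0 < g x) {ν : ℝ} (hν : 0 ≤ ν) :
    Integrable (fun x => ageCdf F (ν * g x)) (volume.restrict (Ioc (0 : ℝ) 1)) := by
  refine Integrable.of_bound (continuous_ageCdf.comp_aestronglyMeasurable
    ((hg.aestronglyMeasurable measurableSet_Ioc).const_mul ν)) 1 ?_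
  filter_upwards [hpos] with x hx
  exact abs_ageCdf_le_one hsupp hmean (mul_nonneg hν hx.le)

omit [∀ j, IsProbabilityMeasure (Ψ j)] in
lemma occupancy_zero : occupancy b Ψ f 0 = 0 := by simp [occupancy]

lemma continuousOn_occupancy (hsupp : ∀ j, Ψ j (Iio 0) = 0) (hmean : ∀ j, ∫ x, x ∂(Ψ j) = 1)
    (hf : ∀ j, ContinuousOn (f j) (Ioc 0 1))
    (hpos : ∀ j, ∀ᵐ x ∂(volume.restrict (Ioc (0 : ℝ) 1)), 0 < f j x) :
    ContinuousOn (occupancy b Ψ f) (Ici 0) := by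
  unfold occupancy
  refine continuousOn_finsetSum _ fun j _ => continuousOn_const.mul ?_
  simp only [intervalIntegral.integral_of_le zero_le_one]
  refine continuousOn_of_dominated (bound := fun _ => 1) (fun ν hν =>
    (integrable_ageCdf_comp (hsupp j) (hmean j) (hf j) (hpos j) hν).aestronglyMeasurable)
    (fun ν hν => ?_) (integrable_const _) (ae_of_all _ fun x =>
      (continuous_ageCdf.comp (continuous_id.mul continuous_const)).continuousOn)
  filter_upwards [hpos j] with x hx
  exact abs_ageCdf_le_one (hsupp j) (hmean j) (mul_nonneg hν hx.le)

lemma tendsto_occupancy_atTop (hsupp : ∀ j, Ψ j (Iio 0) = 0) (hmean : ∀ j, ∫ x, x ∂(Ψ j) = 1)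
    (hf : ∀ j, ContinuousOn (f j) (Ioc 0 1))
    (hpos : ∀ j, ∀ᵐ x ∂(volume.restrict (Ioc (0 : ℝ) 1)), 0 < f j x) (hb_sum : ∑ j, b j = 1) :
    Tendsto (occupancy b Ψ f) atTop (𝓝 1) := by
  have h : ∀ j, Tendsto (fun ν => ∫ x in (0 : ℝ)..1, ageCdf (Ψ j) (ν * f j x)) atTop (𝓝 1) := by
    intro j
    simp only [intervalIntegral.integral_of_le zero_le_one]
    have := tendsto_integral_filter_of_dominated_convergence (l := atTop)
      (μ := volume.restrict (Ioc (0 : ℝ) 1)) (F := fun ν x => ageCdf (Ψ j) (ν * f j x))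
      (f := fun _ => (1 : ℝ)) (fun _ => 1)
      (by
        filter_upwards [eventually_ge_atTop 0] with ν hν
        exact (integrable_ageCdf_comp (hsupp j) (hmean j) (hf j) (hpos j) hν).aestronglyMeasurable)
      (by
        filter_upwards [eventually_ge_atTop 0] with ν hν
        filter_upwards [hpos j] with x hx
        exact abs_ageCdf_le_one (hsupp j) (hmean j) (mul_nonneg hν hx.le))
      (integrable_const _)
      (by
        filter_upwards [hpos j] with x hx
        exact (tendsto_ageCdf_atTop (hsupp j) (hmean j)).comp (tendsto_id.atTop_mul_const hx))
    simpa using this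
  have h2 : Tendsto (occupancy b Ψ f) atTop (𝓝 (∑ j, b j * 1)) :=
    tendsto_finsetSum _ fun j _ => (h j).const_mul (b j)
  simpa [hb_sum] using h2

/-- Equality would force, in every class and for almost every `x`, the age distribution to take the
same value at `ν f(x) < ν' f(x)`. That value is then `1`, and both occupancies equal `∑ j, b j = 1`.
-/
lemma occupancy_lt_of_lt (hsupp : ∀ j, Ψ j (Iio 0) = 0) (hmean : ∀ j, ∫ x, x ∂(Ψ j) = 1)
    (hf : ∀ j, ContinuousOn (f j) (Ioc 0 1))
    (hpos : ∀ j, ∀ᵐ x ∂(volume.restrict (Ioc (0 : ℝ) 1)), 0 < f j x) (hb : ∀ j, 0 < b j)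
    (hb_sum : ∑ j, b j = 1) {ν ν' : ℝ} (hν : 0 ≤ ν) (hlt : ν < ν')
    (h1 : occupancy b Ψ f ν < 1 ∨ occupancy b Ψ f ν' < 1) :
    occupancy b Ψ f ν < occupancy b Ψ f ν' := by
  have hI := fun j => integrable_ageCdf_comp (hsupp j) (hmean j) (hf j) (hpos j) hν
  have hI' := fun j => integrable_ageCdf_comp (hsupp j) (hmean j) (hf j) (hpos j)
    (hν.trans hlt.le)
  have hle : ∀ j, (fun x => ageCdf (Ψ j) (ν * f j x)) ≤ᵐ[volume.restrict (Ioc (0 : ℝ) 1)]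
      fun x => ageCdf (Ψ j) (ν' * f j x) := fun j => by
    filter_upwards [hpos j] with x hx
    exact monotone_ageCdf (hmean j) (mul_le_mul_of_nonneg_right hlt.le hx.le)
  have hterm : ∀ j, b j * ∫ x in (0 : ℝ)..1, ageCdf (Ψ j) (ν * f j x)
      ≤ b j * ∫ x in (0 : ℝ)..1, ageCdf (Ψ j) (ν' * f j x) := fun j => by
    simp only [intervalIntegral.integral_of_le zero_le_one]
    exact mul_le_mul_of_nonneg_left (integral_mono_ae (hI j) (hI' j) (hle j)) (hb j).le
  have hmono : occupancy b Ψ f ν ≤ occupancy b Ψ f ν' := Finset.sum_le_sum fun j _ => hterm j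
  refine lt_of_le_of_ne hmono fun heq => ?_
  have h1' : occupancy b Ψ f ν < 1 := h1.elim id fun h => heq ▸ h
  refine absurd ?_ h1'.ne
  have hj := (Finset.sum_eq_sum_iff_of_le fun j _ => hterm j).1 heq
  refine Eq.trans ?_ hb_sum
  refine Finset.sum_congr rfl fun j _ => ?_
  have hj' := mul_left_cancel₀ (hb j).ne' (hj j (Finset.mem_univ j))
  simp only [intervalIntegral.integral_of_le zero_le_one] at hj' ⊢
  have hae := (integral_eq_iff_of_ae_le (hI j) (hI' j) (hle j)).1 hj'
  have h1ae : (fun x => ageCdf (Ψ j) (ν * f j x)) =ᵐ[volume.restrict (Ioc (0 : ℝ) 1)]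
      fun _ => 1 := by
    filter_upwards [hae, hpos j] with x hx hfx
    exact ageCdf_eq_one_of_eq (hsupp j) (hmean j) (mul_lt_mul_of_pos_right hlt hfx) hx
  rw [integral_congr_ae h1ae]; simp

lemma existsUnique_occupancy_eq (hsupp : ∀ j, Ψ j (Iio 0) = 0)
    (hmean : ∀ j, ∫ x, x ∂(Ψ j) = 1) (hf : ∀ j, ContinuousOn (f j) (Ioc 0 1))
    (hpos : ∀ j, ∀ᵐ x ∂(volume.restrict (Ioc (0 : ℝ) 1)), 0 < f j x) (hb : ∀ j, 0 < b j)
    (hb_sum : ∑ j, b j = 1) {β : ℝ} (hβ : β ∈ Ioo (0 : ℝ) 1) :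
    ∃! ν : ℝ, 0 < ν ∧ occupancy b Ψ f ν = β := by
  obtain ⟨M, hM, hM0⟩ := (((tendsto_occupancy_atTop hsupp hmean hf hpos hb_sum).eventually
    (lt_mem_nhds hβ.2)).and (eventually_ge_atTop 0)).exists
  obtain ⟨ν, hν, hνβ⟩ := intermediate_value_Icc hM0
    ((continuousOn_occupancy (b := b) hsupp hmean hf hpos).mono Icc_subset_Ici_self)
    (show β ∈ Icc (occupancy b Ψ f 0) (occupancy b Ψ f M) from
      ⟨occupancy_zero.trans_le hβ.1.le, hM.le⟩)
  have hν0 : 0 < ν := by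
    refine lt_of_le_of_ne hν.1 ?_
    rintro rfl
    rw [occupancy_zero] at hνβ
    exact hβ.1.ne hνβ
  refine ⟨ν, ⟨hν0, hνβ⟩, ?_⟩
  rintro ν' ⟨hν'0, hν'β⟩
  rcases lt_trichotomy ν' ν with h | h | h
  · have := occupancy_lt_of_lt hsupp hmean hf hpos hb hb_sum hν'0.le h
      (Or.inl (hν'β ▸ hβ.2))
    rw [hν'β, hνβ] at this
    exact absurd this (lt_irrefl _)
  · exact h
  · have := occupancy_lt_of_lt hsupp hmean hf hpos hb hb_sum hν0.le h (Or.inl (hνβ ▸ hβ.2))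
    rw [hν'β, hνβ] at this
    exact absurd this (lt_irrefl _)

omit [∀ j, IsProbabilityMeasure (Ψ j)] in
lemma continuous_mul_cdf {F : Measure ℝ} [IsProbabilityMeasure F] (hc : Continuous (cdf F))
    {g : ℝ → ℝ} (hg : Integrable g (volume.restrict (Ioc (0 : ℝ) 1))) :
    Continuous (fun ν => ∫ x in (0 : ℝ)..1, g x * cdf F (ν * g x)) ∧
    ∀ ν, Integrable (fun x => g x * cdf F (ν * g x)) (volume.restrict (Ioc (0 : ℝ) 1)) := by
  have hi : ∀ ν, Integrable (fun x => g x * cdf F (ν * g x)) (volume.restrict (Ioc (0 : ℝ) 1)) :=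
    fun ν => hg.mul_bdd (c := 1)
      (hc.comp_aestronglyMeasurable (hg.aestronglyMeasurable.const_mul ν))
      (ae_of_all _ fun x => abs_cdf_le_one F _)
  refine ⟨?_, hi⟩
  simp only [intervalIntegral.integral_of_le zero_le_one]
  refine continuous_of_dominated (bound := fun x => |g x|) (fun ν => (hi ν).aestronglyMeasurable)
    (fun ν => ae_of_all _ fun x => ?_) hg.abs (ae_of_all _ fun x => by fun_prop)
  rw [norm_mul, Real.norm_eq_abs, Real.norm_eq_abs]
  exact mul_le_of_le_one_right (abs_nonneg _) (abs_cdf_le_one F _)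

lemma continuous_profileHit (hc : ∀ j, Continuous (cdf (Ψ j)))
    (hf : ∀ j, Integrable (f j) (volume.restrict (Ioc (0 : ℝ) 1))) :
    Continuous (profileHit b Ψ f) :=
  continuous_finsetSum _ fun j _ => continuous_const.mul (continuous_mul_cdf (hc j) (hf j)).1

end Occupancy

/-! ### Convergence along popularity profiles -/

section Profile

/-- In the cell containing `x`, the value is `f(z)` divided by the ratio `f(z) / a`. The sample
point `z` tends to `x` within `(0, 1]` and the ratio tends to `1`. -/
lemma tendsto_stepFun {m : ℕ → ℕ} (hm : Tendsto m atTop atTop) {a z : ∀ n, Fin (m n) → ℝ}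
    {f : ℝ → ℝ} (hf : ContinuousOn f (Ioc 0 1))
    (hz : ∀ n k, 0 < z n k ∧ z n k ∈ Icc ((k : ℝ) / (m n : ℝ)) (((k : ℝ) + 1) / (m n : ℝ)))
    (hpop : ∀ ε > 0, ∀ᶠ n in atTop, ∀ k, |f (z n k) / a n k - 1| < ε) {x : ℝ}
    (hx : x ∈ Ioc (0 : ℝ) 1) :
    Tendsto (fun n => stepFun (a n) x) atTop (𝓝 (f x)) := by
  have hmpos : ∀ᶠ n in atTop, 0 < m n := hm.eventually_gt_atTop 0
  have hζmem : ∀ᶠ n in atTop, stepFun (z n) x ∈ Ioc (0 : ℝ) 1 := by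
    filter_upwards [hmpos] with n hn
    obtain ⟨k, hk⟩ := exists_mem_Ioc_div hn hx
    rw [stepFun_of_mem _ hk]
    refine ⟨(hz n k).1, (hz n k).2.2.trans ?_⟩
    rw [div_le_one (Nat.cast_pos.2 hn)]
    exact_mod_cast k.2
  have hζ : Tendsto (fun n => stepFun (z n) x) atTop (𝓝 x) := by
    have h0 : Tendsto (fun n => (m n : ℝ)⁻¹) atTop (𝓝 0) :=
      tendsto_inv_atTop_zero.comp (tendsto_natCast_atTop_atTop.comp hm)
    rw [tendsto_iff_dist_tendsto_zero]
    refine squeeze_zero' (Eventually.of_forall fun n => dist_nonneg) ?_ h0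
    filter_upwards [hmpos] with n hn
    obtain ⟨k, hk⟩ := exists_mem_Ioc_div hn hx
    rw [stepFun_of_mem _ hk, Real.dist_eq, abs_le]
    have h1 := (hz n k).2
    have h2 : ((k : ℝ) + 1) / m n = k / m n + (m n : ℝ)⁻¹ := by rw [add_div, one_div]
    rw [h2] at hk h1
    constructor <;> linarith [hk.1, hk.2, h1.1, h1.2]
  have hfζ : Tendsto (fun n => f (stepFun (z n) x)) atTop (𝓝 (f x)) :=
    (hf x hx).tendsto.comp (tendsto_nhdsWithin_iff.2 ⟨hζ, hζmem⟩)
  have hr : Tendsto (fun n => stepFun (fun k => f (z n k) / a n k) x) atTop (𝓝 1) := by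
    rw [Metric.tendsto_nhds]
    intro ε hε
    filter_upwards [hmpos, hpop ε hε] with n hn hnε
    obtain ⟨k, hk⟩ := exists_mem_Ioc_div hn hx
    rw [stepFun_of_mem _ hk, Real.dist_eq]
    exact hnε k
  have hd := hfζ.div hr one_ne_zero
  rw [div_one] at hd
  refine hd.congr' ?_
  filter_upwards [hmpos, hpop 1 one_pos] with n hn hn1
  obtain ⟨k, hk⟩ := exists_mem_Ioc_div hn hx
  rw [Pi.div_apply, stepFun_of_mem _ hk, stepFun_of_mem _ hk, stepFun_of_mem _ hk]
  have h1 := (abs_lt.1 (hn1 k)).1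
  -- A vanishing `f(z)` would make the ratio `0`, at distance exactly one from `1`.
  have hne : f (z n k) ≠ 0 := fun h => by
    rw [h, zero_div] at h1; linarith
  rw [div_div_cancel₀ hne]

/-- Once the ratio `f(z) / a` exceeds `1/2`, one has `a < 2 f(z)`. -/
lemma eventually_stepFun_le {m : ℕ → ℕ} (hm : Tendsto m atTop atTop) {a z : ∀ n, Fin (m n) → ℝ}
    (ha : ∀ᶠ n in atTop, ∀ k, 0 < a n k) {f : ℝ → ℝ}
    (hz : ∀ n k, 0 < z n k ∧ z n k ∈ Icc ((k : ℝ) / (m n : ℝ)) (((k : ℝ) + 1) / (m n : ℝ)))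
    (hpop : ∀ ε > 0, ∀ᶠ n in atTop, ∀ k, |f (z n k) / a n k - 1| < ε) {M : ℝ}
    (hM : ∀ x ∈ Ioc (0 : ℝ) 1, f x ≤ M) :
    ∀ᶠ n in atTop, ∀ x ∈ Ioc (0 : ℝ) 1, stepFun (a n) x ≤ 2 * M := by
  filter_upwards [hm.eventually_gt_atTop 0, hpop (1 / 2) (by norm_num), ha] with n hn hn1 han x hx
  obtain ⟨k, hk⟩ := exists_mem_Ioc_div hn hx
  rw [stepFun_of_mem _ hk]
  have hzm : z n k ∈ Ioc (0 : ℝ) 1 := by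
    refine ⟨(hz n k).1, (hz n k).2.2.trans ?_⟩
    rw [div_le_one (Nat.cast_pos.2 hn)]
    exact_mod_cast k.2
  have h1 := (abs_lt.1 (hn1 k)).1
  have h2 : 1 / 2 < f (z n k) / a n k := by linarith
  rw [lt_div_iff₀ (han k)] at h2
  linarith [hM _ hzm]

lemma exists_bound_of_tendsto {f : ℝ → ℝ} (hf : ContinuousOn f (Ioc 0 1)) {l : ℝ}
    (hl : Tendsto f (𝓝[>] 0) (𝓝 l)) : ∃ M, ∀ x ∈ Ioc (0 : ℝ) 1, f x ≤ M := by
  have h1 := hl.eventually (gt_mem_nhds (lt_add_one l))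
  obtain ⟨δ, hδ, hδf⟩ := mem_nhdsGT_iff_exists_Ioo_subset.1 h1
  have hδ0 : (0 : ℝ) < δ := hδ
  obtain ⟨M, hM⟩ := (isCompact_Icc (a := δ) (b := 1)).bddAbove_image
    (hf.mono fun x hx => ⟨hδ0.trans_le hx.1, hx.2⟩)
  refine ⟨max (l + 1) M, fun x hx => ?_⟩
  rcases lt_or_ge x δ with h | h
  · exact le_max_of_le_left (le_of_lt (hδf ⟨hx.1, h⟩))
  · exact le_max_of_le_right (hM (mem_image_of_mem f ⟨h, hx.2⟩))

lemma sum_comp_eq_integral_stepFun {m : ℕ} (a : Fin m → ℝ) (φ : ℝ → ℝ) :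
    ∑ k, φ (a k) = m * ∫ x in Ioc (0 : ℝ) 1, φ (stepFun a x) := by
  rcases Nat.eq_zero_or_pos m with rfl | hm
  · simp
  · rw [setIntegral_congr_fun measurableSet_Ioc fun x hx => stepFun_comp a hm φ hx,
      integral_stepFun _ hm]
    field_simp

/-- An integrability criterion: the pointwise limit of nonnegative functions with bounded
integrals. -/
lemma integrable_of_tendsto_of_integral_le {α : Type*} [MeasurableSpace α] {μ : Measure α}
    {h : ℕ → α → ℝ} {f : α → ℝ} (hint : ∀ n, Integrable (h n) μ) (hnn : ∀ n, 0 ≤ᵐ[μ] h n)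
    (hlim : ∀ᵐ x ∂μ, Tendsto (fun n => h n x) atTop (𝓝 (f x))) {K : ℝ}
    (hK : ∀ᶠ n in atTop, ∫ x, h n x ∂μ ≤ K) : Integrable f μ := by
  have hfm : AEStronglyMeasurable f μ :=
    aestronglyMeasurable_of_tendsto_ae atTop (fun n => (hint n).aestronglyMeasurable) hlim
  refine ⟨hfm, ?_⟩
  -- Fatou's lemma for the norms, whose lower limit is the norm of `f`.
  have hfatou := lintegral_liminf_le' (μ := μ) (u := atTop) (f := fun n x => ‖h n x‖ₑ)
    fun n => (hint n).aestronglyMeasurable.enorm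
  have heq : ∫⁻ x, ‖f x‖ₑ ∂μ = ∫⁻ x, liminf (fun n => ‖h n x‖ₑ) atTop ∂μ := by
    refine lintegral_congr_ae ?_
    filter_upwards [hlim] with x hx
    exact ((continuous_enorm.tendsto _).comp hx).liminf_eq.symm
  rw [hasFiniteIntegral_iff_enorm, heq]
  refine hfatou.trans_lt (lt_of_le_of_lt (b := ENNReal.ofReal K) ?_ ENNReal.ofReal_lt_top)
  have hb : ∀ᶠ n in atTop, ∫⁻ x, ‖h n x‖ₑ ∂μ ≤ ENNReal.ofReal K := ?_
  · exact liminf_le_of_frequently_le' hb.frequently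
  filter_upwards [hK] with n hn
  rw [← ofReal_integral_norm_eq_lintegral_enorm (hint n)]
  refine ENNReal.ofReal_le_ofReal (le_trans (le_of_eq (integral_congr_ae ?_)) hn)
  filter_upwards [hnn n] with x hx
  exact Real.norm_of_nonneg hx

end Profile

/-- The limits of the class sums along popularity profiles. -/
theorem tendsto_profile_sums (J : ℕ) (b : Fin J → ℝ) (hb : ∀ j, 0 < b j) (size : ℕ → Fin J → ℕ)
    (h_size : Tendsto (fun n => ∑ j, size n j) atTop atTop)
    (h_frac : ∀ j, Tendsto (fun n => (size n j : ℝ) / ((∑ l, size n l : ℕ) : ℝ)) atTop (𝓝 (b j)))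
    (p : ∀ n (j : Fin J), Fin (size n j) → ℝ) (hp : ∀ n j k, 0 < p n j k)
    (hp_sum : ∀ n, 0 < ∑ j, size n j → ∑ j, ∑ k, p n j k = 1)
    (f : Fin J → ℝ → ℝ) (hf_cont : ∀ j, ContinuousOn (f j) (Ioc 0 1))
    (hf_pos : ∀ j, ∀ᵐ x ∂(volume.restrict (Ioc (0 : ℝ) 1)), 0 < f j x)
    (hf_lim : ∀ j, (∃ l, 0 ≤ l ∧ Tendsto (f j) (𝓝[>] 0) (𝓝 l)) ∨
      Tendsto (f j) (𝓝[>] 0) atTop)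
    (z : ∀ n (j : Fin J), Fin (size n j) → ℝ)
    (hz : ∀ n j k, 0 < z n j k ∧
      z n j k ∈ Icc ((k : ℝ) / (size n j : ℝ)) (((k : ℝ) + 1) / (size n j : ℝ)))
    (h_pop : ∀ j, ∀ ε > 0, ∀ᶠ n in atTop, ∀ k,
      |f j (z n j k) / (((∑ l, size n l : ℕ) : ℝ) * p n j k) - 1| < ε)
    (hf_norm : (∃ j, Tendsto (f j) (𝓝[>] 0) atTop) →
      ∑ j, b j * ∫ x in (0 : ℝ)..1, f j x = 1) :
    (∀ j, Integrable (f j) (volume.restrict (Ioc (0 : ℝ) 1))) ∧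
    (∀ φ : Fin J → ℝ → ℝ, (∀ j, Continuous (φ j)) → (∀ j x, |φ j x| ≤ 1) →
      Tendsto (fun n => ∑ j, ∑ k, p n j k * φ j (((∑ l, size n l : ℕ) : ℝ) * p n j k)) atTop
        (𝓝 (∑ j, b j * ∫ x in (0 : ℝ)..1, f j x * φ j (f j x)))) ∧
    (∀ φ : Fin J → ℝ → ℝ, (∀ j, Continuous (φ j)) → (∀ j x, 0 ≤ x → |φ j x| ≤ 1) →
      Tendsto (fun n => (∑ j, ∑ k, φ j (((∑ l, size n l : ℕ) : ℝ) * p n j k))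
          / ((∑ l, size n l : ℕ) : ℝ)) atTop
        (𝓝 (∑ j, b j * ∫ x in (0 : ℝ)..1, φ j (f j x)))) := by
  simp only [intervalIntegral.integral_of_le zero_le_one] at hf_norm ⊢
  set N : ℕ → ℝ := fun n => ((∑ l, size n l : ℕ) : ℝ) with hN
  have hN0 : ∀ᶠ n in atTop, 0 < ∑ j, size n j := h_size.eventually_gt_atTop 0
  have hNtop : Tendsto N atTop atTop := tendsto_natCast_atTop_atTop.comp h_size
  set w : ℕ → Fin J → ℝ := fun n j => (size n j : ℝ) / N n with hw
  have hw0 : ∀ n j, 0 ≤ w n j := fun n j => by positivity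
  set h : ℕ → Fin J → ℝ → ℝ := fun n j => stepFun fun k => N n * p n j k with hh
  -- Each class grows without bound because its limiting fraction is positive.
  have hm : ∀ j, Tendsto (fun n => size n j) atTop atTop := fun j => by
    rw [← tendsto_natCast_atTop_iff (R := ℝ)]
    refine ((h_frac j).pos_mul_atTop (hb j) hNtop).congr' ?_
    filter_upwards [hN0] with n hn
    exact div_mul_cancel₀ _ (Nat.cast_ne_zero.2 hn.ne')
  have hint : ∀ n j, Integrable (h n j) (volume.restrict (Ioc (0 : ℝ) 1)) :=
    fun n j => integrable_stepFun _
  have hnn' : ∀ n j x, 0 ≤ h n j x := fun n j x =>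
    stepFun_nonneg _ (fun k => mul_nonneg (Nat.cast_nonneg _) (hp n j k).le) x
  have hnn : ∀ n j, 0 ≤ᵐ[volume.restrict (Ioc (0 : ℝ) 1)] h n j :=
    fun n j => ae_of_all _ (hnn' n j)
  have hfnn : ∀ j, 0 ≤ᵐ[volume.restrict (Ioc (0 : ℝ) 1)] f j := fun j => by
    filter_upwards [hf_pos j] with x hx using hx.le
  have hlim : ∀ j, ∀ᵐ x ∂(volume.restrict (Ioc (0 : ℝ) 1)),
      Tendsto (fun n => h n j x) atTop (𝓝 (f j x)) := fun j => by
    filter_upwards [ae_restrict_mem measurableSet_Ioc] with x hx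
    exact tendsto_stepFun (hm j) (hf_cont j) (fun n k => hz n j k) (h_pop j) hx
  have hsums : ∀ (φ : ℝ → ℝ) n j,
      ∑ k, φ (N n * p n j k) = size n j * ∫ x in Ioc (0 : ℝ) 1, φ (h n j x) :=
    fun φ n j => sum_comp_eq_integral_stepFun (fun k => N n * p n j k) φ
  have hmass : ∀ᶠ n in atTop, ∑ j, w n j * ∫ x in Ioc (0 : ℝ) 1, h n j x = 1 := by
    filter_upwards [hN0] with n hn
    have hNn : N n ≠ 0 := Nat.cast_ne_zero.2 hn.ne'
    refine Eq.trans ?_ (hp_sum n hn)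
    refine Finset.sum_congr rfl fun j _ => ?_
    have := hsums id n j
    simp only [id] at this
    rw [← Finset.mul_sum] at this
    simp only [hw]
    rw [div_mul_eq_mul_div, ← this, mul_div_cancel_left₀ _ hNn]
  -- The weighted masses sum to one and the weight is eventually above `b j / 2`, so the mass of `h
  -- n j` is at most `(b j / 2)⁻¹`.
  have hfint : ∀ j, Integrable (f j) (volume.restrict (Ioc (0 : ℝ) 1)) := fun j => by
    refine integrable_of_tendsto_of_integral_le (fun n => hint n j) (fun n => hnn n j) (hlim j)
      (K := (b j / 2)⁻¹) ?_
    filter_upwards [hmass, (h_frac j).eventually (lt_mem_nhds (half_lt_self (hb j)))]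
      with n hn hwn
    have h0 : ∀ j, 0 ≤ w n j * ∫ x in Ioc (0 : ℝ) 1, h n j x := fun j =>
      mul_nonneg (hw0 n j) (integral_nonneg (hnn' n j))
    have h1 := Finset.single_le_sum (f := fun j => w n j * ∫ x in Ioc (0 : ℝ) 1, h n j x)
      (fun j _ => h0 j) (Finset.mem_univ j)
    rw [hn] at h1
    have hb2 : 0 < b j / 2 := half_pos (hb j)
    rw [← one_div, le_div_iff₀ hb2, mul_comm]
    exact (mul_le_mul_of_nonneg_right hwn.le (integral_nonneg (hnn' n j))).trans h1
  -- No mass may be lost in the limit. If a profile blows up at `0`, mass could escape there, and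
  -- the normalisation excludes this. Otherwise all profiles are bounded and dominated convergence
  -- passes the total mass to the limit.
  have hone : ∑ j, b j * ∫ x in Ioc (0 : ℝ) 1, f j x = 1 := by
    by_cases hex : ∃ j, Tendsto (f j) (𝓝[>] 0) atTop
    · exact hf_norm hex
    · rw [not_exists] at hex
      have hconv : ∀ j, Tendsto (fun n => ∫ x in Ioc (0 : ℝ) 1, h n j x) atTop
          (𝓝 (∫ x in Ioc (0 : ℝ) 1, f j x)) := fun j => by
        obtain ⟨l, -, hl⟩ := (hf_lim j).resolve_right (hex j)
        obtain ⟨M, hM⟩ := exists_bound_of_tendsto (hf_cont j) hl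
        refine tendsto_integral_filter_of_dominated_convergence (fun _ => 2 * M)
          (Eventually.of_forall fun n => (hint n j).aestronglyMeasurable) ?_
          (integrable_const _) (hlim j)
        have hmpos : ∀ᶠ n in atTop, 0 < N n := hNtop.eventually_gt_atTop 0
        have hpos : ∀ᶠ n in atTop, ∀ k, 0 < N n * p n j k := by
          filter_upwards [hmpos] with n hn k using mul_pos hn (hp n j k)
        filter_upwards [eventually_stepFun_le (hm j) hpos (fun n k => hz n j k) (h_pop j) hM]
          with n hn
        filter_upwards [ae_restrict_mem measurableSet_Ioc] with x hx
        rw [Real.norm_of_nonneg (hnn' n j x)]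
        exact hn x hx
      have h1 : Tendsto (fun n => ∑ j, w n j * ∫ x in Ioc (0 : ℝ) 1, h n j x) atTop
          (𝓝 (∑ j, b j * ∫ x in Ioc (0 : ℝ) 1, f j x)) :=
        tendsto_finsetSum _ fun j _ => (h_frac j).mul (hconv j)
      exact tendsto_nhds_unique h1
        (tendsto_const_nhds.congr' (hmass.mono fun n hn => hn.symm))
  have hL1 := tendsto_integral_abs_sub_of_tendsto_sum hint hnn hfint hfnn hlim h_frac hw0 hb (by
    rw [hone]
    exact tendsto_const_nhds.congr' (hmass.mono fun n hn => hn.symm))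
  refine ⟨hfint, fun φ hφ hφ1 => ?_, fun φ hφ hφ1 => ?_⟩
  · have h1 : Tendsto (fun n => ∑ j, w n j * ∫ x in Ioc (0 : ℝ) 1, h n j x * φ j (h n j x)) atTop
        (𝓝 (∑ j, b j * ∫ x in Ioc (0 : ℝ) 1, f j x * φ j (f j x))) :=
      tendsto_finsetSum _ fun j _ => (h_frac j).mul (tendsto_integral_mul_comp
        (fun n => hint n j) (hfint j) (hlim j) (hL1 j) (hφ j) (hφ1 j))
    refine h1.congr' ?_
    filter_upwards [hN0] with n hn
    have hNn : N n ≠ 0 := Nat.cast_ne_zero.2 hn.ne'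
    refine Finset.sum_congr rfl fun j _ => ?_
    have := hsums (fun y => y * φ j y) n j
    simp only [mul_assoc, ← Finset.mul_sum] at this
    simp only [hw]
    rw [div_mul_eq_mul_div, ← this, mul_div_cancel_left₀ _ hNn]
  -- Here `φ` is bounded on the range of the step functions, so pointwise convergence and dominated
  -- convergence are enough.
  · have h1 : Tendsto (fun n => ∑ j, w n j * ∫ x in Ioc (0 : ℝ) 1, φ j (h n j x)) atTop
        (𝓝 (∑ j, b j * ∫ x in Ioc (0 : ℝ) 1, φ j (f j x))) := by
      refine tendsto_finsetSum _ fun j _ => (h_frac j).mul ?_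
      refine tendsto_integral_of_dominated_convergence (fun _ => 1)
        (fun n => (hφ j).comp_aestronglyMeasurable (hint n j).aestronglyMeasurable)
        (integrable_const _) (fun n => ae_of_all _ fun x => hφ1 j _ (hnn' n j x)) ?_
      filter_upwards [hlim j] with x hx
      exact ((hφ j).tendsto _).comp hx
    refine h1.congr fun n => ?_
    rw [Finset.sum_div]
    refine Finset.sum_congr rfl fun j _ => ?_
    rw [hsums (φ j) n j, div_mul_eq_mul_div]

/-! ### The limit of the hit probability -/

/-- A change of variables in the age distribution. -/
lemma mul_integral_one_sub_cdf_eq_ageCdf {F : Measure ℝ} (hmean : ∫ x, x ∂F = 1) (r t : ℝ) :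
    r * ∫ u in (0 : ℝ)..t, (1 - cdf F (r * u)) = ageCdf F (r * t) := by
  rw [ageCdf_eq hmean, intervalIntegral.mul_integral_comp_mul_left (f := fun u => 1 - cdf F u),
    mul_zero]

theorem mainTheorem5
    -- `J` classes of contents with asymptotic fractions `b j`;
    -- the `n`-th system has `size n j` contents in class `j`
    (J : ℕ) (b : Fin J → ℝ) (hb : ∀ j, 0 < b j) (hb_sum : ∑ j, b j = 1)
    (size : ℕ → Fin J → ℕ)
    (h_size : Tendsto (fun n => ∑ j, size n j) atTop atTop)
    (h_frac : ∀ j, Tendsto (fun n => (size n j : ℝ) / ((∑ l, size n l : ℕ) : ℝ)) atTop (𝓝 (b j)))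
    -- cache sizes
    (C : ℕ → ℕ) (β₀ : ℝ) (hβ₀ : β₀ ∈ Ioo (0 : ℝ) 1)
    (hC : Tendsto (fun n => (C n : ℝ) / ((∑ l, size n l : ℕ) : ℝ)) atTop (𝓝 β₀))
    -- independent stationary ergodic request processes with positive finite intensities
    (Ω : ℕ → Type*) [∀ n, MeasurableSpace (Ω n)]
    (P : ∀ n, Measure (Ω n)) [∀ n, IsProbabilityMeasure (P n)]
    (R : ∀ n, (Σ j : Fin J, Fin (size n j)) → Ω n → PointConfig)
    (hR : ∀ n i, IsStationaryErgodic (P n) (R n i))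
    (hR_indep : ∀ n, iIndepFun (R n) (P n))
    (hR_rate : ∀ n i, 0 < intensity (P n) (R n i) ∧ intensity (P n) (R n i) < ∞)
    -- the standard inter-request distributions, with cdf `cdf (Ψ j)`
    (Ψ : Fin J → Measure ℝ) [∀ j, IsProbabilityMeasure (Ψ j)]
    (hΨ_cont : ∀ j, Continuous (cdf (Ψ j)))
    (hΨ_supp : ∀ j, Ψ j (Iio 0) = 0)
    (hΨ_mean : ∀ j, ∫ x, x ∂(Ψ j) = 1)
    (hG : ∀ n j k t, interRequestCdf (P n) (R n) ⟨j, k⟩ t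
      = cdf (Ψ j) (rate (P n) (R n) ⟨j, k⟩ * t))
    -- the popularity profiles
    (f : Fin J → ℝ → ℝ)
    (hf_cont : ∀ j, ContinuousOn (f j) (Ioc 0 1))
    (hf_pos : ∀ j, ∀ᵐ x ∂(volume.restrict (Ioc (0 : ℝ) 1)), 0 < f j x)
    (hf_lim : ∀ j, (∃ l, 0 ≤ l ∧ Tendsto (f j) (𝓝[>] 0) (𝓝 l)) ∨
      Tendsto (f j) (𝓝[>] 0) atTop)
    (z : ∀ n (j : Fin J), Fin (size n j) → ℝ)
    (hz : ∀ n j k, 0 < z n j k ∧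
      z n j k ∈ Icc ((k : ℝ) / (size n j : ℝ)) (((k : ℝ) + 1) / (size n j : ℝ)))
    (h_pop : ∀ j, ∀ ε > 0, ∀ᶠ n in atTop, ∀ k,
      |f j (z n j k) / (((∑ l, size n l : ℕ) : ℝ) * popularity (P n) (R n) ⟨j, k⟩) - 1| < ε)
    -- if some profile is unbounded, the profiles are normalised
    (hf_norm : (∃ j, Tendsto (f j) (𝓝[>] 0) atTop) →
      ∑ j, b j * ∫ x in (0 : ℝ)..1, f j x = 1) :
    (∃! ν₀ : ℝ, 0 < ν₀ ∧
      ∑ j, b j * ∫ x in (0 : ℝ)..1, ageCdf (Ψ j) (ν₀ * f j x) = β₀) ∧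
    ∀ ν₀ : ℝ, 0 < ν₀ →
      ∑ j, b j * ∫ x in (0 : ℝ)..1, ageCdf (Ψ j) (ν₀ * f j x) = β₀ →
      (∀ j, IntervalIntegrable (fun x => f j x * cdf (Ψ j) (ν₀ * f j x)) volume 0 1) ∧
      Tendsto (fun n => lruHitProb (P n) (R n) (C n)) atTop
        (𝓝 (∑ j, b j * ∫ x in (0 : ℝ)..1, f j x * cdf (Ψ j) (ν₀ * f j x))) := by
  have hN0 : ∀ᶠ n in atTop, 0 < ∑ j, size n j := h_size.eventually_gt_atTop 0
  have hrate : ∀ n i, 0 < rate (P n) (R n) i := fun n i =>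
    ENNReal.toReal_pos (hR_rate n i).1.ne' (hR_rate n i).2.ne
  have hne : ∀ n, 0 < ∑ j, size n j → Nonempty (Σ j : Fin J, Fin (size n j)) := fun n hn => by
    rw [← Fintype.card_pos_iff]
    simpa [Fintype.card_sigma] using hn
  have hΛ : ∀ n, 0 < ∑ j, size n j → 0 < ∑ i, rate (P n) (R n) i := fun n hn => by
    have := hne n hn
    exact Finset.sum_pos (fun i _ => hrate n i) Finset.univ_nonempty
  have hp_pos : ∀ n (j : Fin J) (k : Fin (size n j)), 0 < popularity (P n) (R n) ⟨j, k⟩ :=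
    fun n j k => div_pos (hrate n _)
      (Finset.sum_pos (fun i _ => hrate n i) ⟨⟨j, k⟩, Finset.mem_univ _⟩)
  have hp_sum : ∀ n, 0 < ∑ j, size n j →
      ∑ j, ∑ k, popularity (P n) (R n) (⟨j, k⟩ : Σ j : Fin J, Fin (size n j)) = 1 :=
    fun n hn => by
      rw [← Fintype.sum_sigma]
      simp only [popularity, ← Finset.sum_div]
      exact div_self (hΛ n hn).ne'
  obtain ⟨hfint, hlimS, hlimB⟩ := tendsto_profile_sums J b hb size h_size h_frac
    (fun n j k => popularity (P n) (R n) ⟨j, k⟩) hp_pos hp_sum f hf_cont hf_pos hf_lim z hz h_pop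
    hf_norm
  refine ⟨existsUnique_occupancy_eq hΨ_supp hΨ_mean hf_cont hf_pos hb hb_sum hβ₀,
    fun ν₀ hν₀ hocc => ⟨fun j => ?_, ?_⟩⟩
  · rw [intervalIntegrable_iff_integrableOn_Ioc_of_le zero_le_one]
    exact (continuous_mul_cdf (hΨ_cont j) (hfint j)).2 ν₀
  change occupancy b Ψ f ν₀ = β₀ at hocc
  change Tendsto _ _ (𝓝 (profileHit b Ψ f ν₀))
  set N : ℕ → ℝ := fun n => ((∑ l, size n l : ℕ) : ℝ) with hN
  have hNtop : Tendsto N atTop atTop := tendsto_natCast_atTop_atTop.comp h_size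
  have hNinv : Tendsto (fun n => (N n)⁻¹) atTop (𝓝 0) := tendsto_inv_atTop_zero.comp hNtop
  have hcard : ∀ n, (Fintype.card (Σ j : Fin J, Fin (size n j)) : ℝ) = N n := fun n => by
    simp [hN, Fintype.card_sigma]
  have hc : ∀ n i, Continuous (interRequestCdf (P n) (R n) i) := fun n ⟨j, k⟩ => by
    have : interRequestCdf (P n) (R n) ⟨j, k⟩
        = fun t => cdf (Ψ j) (rate (P n) (R n) ⟨j, k⟩ * t) := funext fun t => hG n j k t
    rw [this]
    exact (hΨ_cont j).comp (continuous_const_mul _)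
  -- This scaling makes the rate of a content times `t ν n` equal to `ν` times its rescaled
  -- popularity, so both the mean count and the hit sum become profile sums.
  set t : ℝ → ℕ → ℝ := fun ν n => ν * N n / ∑ i, rate (P n) (R n) i with ht
  have ht0 : ∀ ν n, 0 < ν → 0 < ∑ j, size n j → 0 < t ν n := fun ν n hν hn =>
    div_pos (mul_pos hν (Nat.cast_pos.2 hn)) (hΛ n hn)
  have hrt : ∀ ν n i, rate (P n) (R n) i * t ν n = ν * (N n * popularity (P n) (R n) i) :=
    fun ν n i => by simp only [ht, popularity]; ring
  have hqsum : ∀ ν, 0 < ν → Tendsto (fun n => (∑ i, rate (P n) (R n) i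
      * ∫ u in (0 : ℝ)..(t ν n), (1 - interRequestCdf (P n) (R n) i u)) / N n) atTop
      (𝓝 (occupancy b Ψ f ν)) := fun ν hν => by
    refine (hlimB (fun j y => ageCdf (Ψ j) (ν * y))
      (fun j => continuous_ageCdf.comp (continuous_const_mul ν))
      (fun j y hy => abs_ageCdf_le_one (hΨ_supp j) (hΨ_mean j) (mul_nonneg hν.le hy))).congr
      fun n => ?_
    rw [Fintype.sum_sigma]
    congr 1
    refine Finset.sum_congr rfl fun j _ => Finset.sum_congr rfl fun k _ => ?_
    simp only [hG]
    rw [mul_integral_one_sub_cdf_eq_ageCdf (hΨ_mean j), hrt]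
  have hSsum : ∀ ν, Tendsto (fun n => ∑ i, popularity (P n) (R n) i
      * interRequestCdf (P n) (R n) i (t ν n)) atTop (𝓝 (profileHit b Ψ f ν)) := fun ν => by
    refine (hlimS (fun j y => cdf (Ψ j) (ν * y))
      (fun j => (hΨ_cont j).comp (continuous_const_mul ν))
      (fun j y => abs_cdf_le_one _ _)).congr fun n => ?_
    rw [Fintype.sum_sigma]
    refine Finset.sum_congr rfl fun j _ => Finset.sum_congr rfl fun k _ => ?_
    rw [hG, hrt]
  -- The Chebyshev error for the deviation `D = δ N` equals `1 / (δ² N)`.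
  have herr : ∀ δ : ℝ, 0 < δ → Tendsto (fun n => N n / (δ * N n) ^ 2) atTop (𝓝 0) := fun δ hδ => by
    have := hNinv.const_mul ((δ ^ 2)⁻¹)
    rw [mul_zero] at this
    refine this.congr' ?_
    filter_upwards [hN0] with n hn
    have hNn : N n ≠ 0 := Nat.cast_ne_zero.2 hn.ne'
    field_simp
  have hcont : Continuous (profileHit b Ψ f) := continuous_profileHit hΨ_cont hfint
  -- The lower bound uses some `ν < ν₀` and the upper bound some `ν > ν₀`, each so close to `ν₀`
  -- that `profileHit` stays on the right side of `a`.
  refine tendsto_order.2 ⟨fun a ha => ?_, fun a ha => ?_⟩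
  · obtain ⟨ν, hνa, hν0, hνν₀⟩ : ∃ ν, a < profileHit b Ψ f ν ∧ 0 < ν ∧ ν < ν₀ := by
      have h1 : ∀ᶠ ν in 𝓝[<] ν₀, a < profileHit b Ψ f ν :=
        (hcont.tendsto ν₀).mono_left nhdsWithin_le_nhds |>.eventually (lt_mem_nhds ha)
      obtain ⟨ν, h, h'⟩ := (h1.and (Ioo_mem_nhdsLT hν₀)).exists
      exact ⟨ν, h, h'.1, h'.2⟩
    have hoccν : occupancy b Ψ f ν < β₀ := hocc ▸ occupancy_lt_of_lt hΨ_supp hΨ_mean hf_cont hf_pos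
      hb hb_sum hν0.le hνν₀ (Or.inr (hocc ▸ hβ₀.2))
    -- Half of the gap serves as the relative deviation, leaving `occupancy` at `ν` below `β₀ - δ`.
    -- The extra `1` in the condition on `C` becomes `(N n)⁻¹` and disappears.
    set δ := (β₀ - occupancy b Ψ f ν) / 2 with hδ
    have hδ0 : 0 < δ := half_pos (sub_pos.2 hoccν)
    have hq := (hC.sub_const δ).sub hNinv
    rw [sub_zero] at hq
    have hq' := (hqsum ν hν0).eventually_lt hq (by linarith)
    have hS := (hSsum ν).sub (herr δ hδ0)
    rw [sub_zero] at hS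
    filter_upwards [hN0, hq', hS.eventually (lt_mem_nhds hνa)] with n hn hqn hSn
    have := hne n hn
    have hNn : 0 < N n := Nat.cast_pos.2 hn
    refine hSn.trans_le ?_
    have key := le_lruHitProb (hR n) (hR_indep n) (hR_rate n) (hc n) (C := C n) (ht0 ν n hν0 hn)
      (mul_pos hδ0 hNn) (by
        rw [div_lt_iff₀ hNn, sub_mul, sub_mul, div_mul_cancel₀ _ hNn.ne',
          inv_mul_cancel₀ hNn.ne'] at hqn
        exact hqn.le)
    rwa [hcard] at key
  · obtain ⟨ν, hνa, hνν₀⟩ : ∃ ν, profileHit b Ψ f ν < a ∧ ν₀ < ν := by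
      have h1 : ∀ᶠ ν in 𝓝[>] ν₀, profileHit b Ψ f ν < a :=
        (hcont.tendsto ν₀).mono_left nhdsWithin_le_nhds |>.eventually (gt_mem_nhds ha)
      exact (h1.and self_mem_nhdsWithin).exists
    have hν0 : 0 < ν := hν₀.trans hνν₀
    -- At `ν > ν₀` the occupancy may already be one; strictness comes from its value `β₀ < 1` at
    -- `ν₀`.
    have hoccν : β₀ < occupancy b Ψ f ν := hocc ▸ occupancy_lt_of_lt hΨ_supp hΨ_mean hf_cont hf_pos
      hb hb_sum hν₀.le hνν₀ (Or.inl (hocc ▸ hβ₀.2))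
    set δ := (occupancy b Ψ f ν - β₀) / 2 with hδ
    have hδ0 : 0 < δ := half_pos (sub_pos.2 hoccν)
    have hq := (hC.add_const δ).add hNinv
    rw [add_zero] at hq
    have hq' := hq.eventually_lt (hqsum ν hν0) (by linarith)
    have hS := (hSsum ν).add (herr δ hδ0)
    rw [add_zero] at hS
    filter_upwards [hN0, hq', hS.eventually (gt_mem_nhds hνa)] with n hn hqn hSn
    have := hne n hn
    have hNn : 0 < N n := Nat.cast_pos.2 hn
    refine lt_of_le_of_lt ?_ hSn
    have key := lruHitProb_le (hR n) (hR_indep n) (hR_rate n) (hc n) (C := C n) (ht0 ν n hν0 hn)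
      (mul_pos hδ0 hNn) (by
        rw [lt_div_iff₀ hNn, add_mul, add_mul, div_mul_cancel₀ _ hNn.ne',
          inv_mul_cancel₀ hNn.ne'] at hqn
        exact hqn.le)
    rwa [hcard] at key
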